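/- **Theorem 1.4 (optimal regularity, $p\le 2$).** Let $p\in(1,2]$, $L>0$. *Elasticae.* A curve $\gamma:[0,L]\to\mathbf R^2$ is a $p$-elastica if $\gamma\in W^{2,p}(0,L;\mathbf R^2)$ is immersed ($\gamma'\neq0$ on $[0,L]$) and there is $\lambda\in\mathbf R$ such that $\frac{d}{d\varepsilon}\big|_{\varepsilon=0}\big(\mathcal B_p[\gamma+\varepsilon\eta]+\lambda\mathcal L[\gamma+\varepsilon\eta]\big)=0$ for all $\eta\in C_c^\infty(0,L;\mathbf R^2)$, where $\mathcal B_p[\gamma]=\int_\gamma|k|^p\,ds$, $\mathcal L[\gamma]=\int_\gamma ds$, $s$ is the arclength and $k$ the counterclockwise signed curvature. *Elliptic functions.* For $q\in[0,1]$ let $F_{1}(x,q)=\int_0^x\frac{|\cos\theta|^{1-2/p}}{\sqrt{1-q^2\sin^2\theta}}d\theta$, $F_{2}(x,q)=\int_0^x(1-q^2\sin^2\theta)^{-1/p}d\theta$, $E_{1}(x,q)=\int_0^x\sqrt{1-q^2\sin^2\theta}\,|\cos\theta|^{1-2/p}d\theta$ and $E_{2}(x,q)=\int_0^x(1-q^2\sin^2\theta)^{(p-1)/p}d\theta$,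 with $x\in\mathbf R$ if $q<1$ and $x\in(-\frac\pi2,\frac\pi2)$ if $q=1$. Let $\mathrm{am}_{i}(\cdot,q):\mathbf R\to\mathbf R$ be the inverse function of $F_{i}(\cdot,q)$ ($i=1,2$), $\mathrm{cn}_p=|\cos\mathrm{am}_{1}|^{\frac2p-1}\cos\mathrm{am}_{1}$, $\mathrm{dn}_p=(1-q^2\sin^2\mathrm{am}_{2})^{1/p}$, $\mathrm{sech}_p\,s=\mathrm{cn}_p(s,1)$, $\tanh_p s=\int_0^s(\mathrm{sech}_p\,t)^p\,dt$. *Types.* The curve $\gamma$ is called linear, wavelike, borderline, orbitlike or circular if, up to similarity (translation, rotation, reflection, dilation) and reparameterization, it is a part of, respectively, $$\gamma_\ell(s)=(s,0),\qquad \gamma_w(s)=\Big(2E_{1}(\mathrm{am}_{1}(s,q),q)-s,\ -\tfrac{qp}{p-1}|\mathrm{cn}_p(s,q)|^{p-2}\mathrm{cn}_p(s,q)\Big)\ \text{for some } q\in(0,1),$$ $$\gamma_b(s)=\Big(2\tanh_p s-s,\ -\tfrac p{p-1}(\mathrm{sech}_p\,s)^{p-1}\Big),$$ $$\gamma_o(s)=\tfrac1{q^2}\Big(2E_{2}(\mathrm{am}_{2}(s,q),q)+(q^2-2)s,\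 -\tfrac p{p-1}\mathrm{dn}_p(s,q)^{p-1}\Big)\ \text{for some } q\in(0,1),\qquad \gamma_c(s)=(\cos s,\sin s).$$ *Statement.* Let $\gamma:[0,L]\to\mathbf R^2$ be an arclength parameterized $p$-elastica, $Z=\{s\in[0,L]:k(s)=0\}$, $m_p=\lceil\frac1{p-1}\rceil$ and, when $\frac1{p-1}$ is not an integer, $r_p=(m_p-\frac1{p-1})^{-1}$. If $\gamma$ is linear, borderline, orbitlike or circular, then $\gamma$ is analytic on $[0,L]$. If $\gamma$ is wavelike and $Z\neq\emptyset$, then: 1. if $\frac1{p-1}$ is an odd integer, $\gamma$ is analytic on $[0,L]$; 2. if $\frac1{p-1}$ is an even integer, $\gamma\in W^{m_p+2,\infty}(0,L;\mathbf R^2)$; if in addition $Z\cap(0,L)\neq\emptyset$, then $\gamma\notin W^{m_p+3,1}(0,L;\mathbf R^2)$; 3. if $\frac1{p-1}$ is not an integer, $\gamma\in W^{m_p+2,r}(0,L;\mathbf R^2)$ for all $r\in[1,r_p)$, and $\gamma\notin W^{m_p+2,r_p}(0,L;\mathbf R^2)$. -/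

import Mathlib

open Set MeasureTheory
open scoped ENNReal ContDiff

noncomputable section

namespace PElastica

/-- The Euclidean plane. -/
abbrev Plane : Type := EuclideanSpace ℝ (Fin 2)

/-! ### Sobolev spaces on a bounded interval -/

/-- `g` is the weak derivative of `f` on the open interval `(a, b)`. -/
def HasWeakDeriv {E : Type*} [NormedAddCommGroup E] [NormedSpace ℝ E]
    (a b : ℝ) (f g : ℝ → E) : Prop :=
  LocallyIntegrableOn f (Ioo a b) volume ∧ LocallyIntegrableOn g (Ioo a b) volume ∧
  ∀ φ : ℝ → ℝ, ContDiff ℝ ∞ φ → HasCompactSupport φ → tsupport φ ⊆ Ioo a b →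
    ∫ x in Ioo a b, deriv φ x • f x = - ∫ x in Ioo a b, φ x • g x

/-- `f ∈ W^{m,r}(a,b;E)`, for `1 ≤ r ≤ ∞`: `f` and its weak derivatives up to order `m`
belong to `L^r(a,b;E)`. -/
def MemSobolev {E : Type*} [NormedAddCommGroup E] [NormedSpace ℝ E]
    (a b : ℝ) (r : ℝ≥0∞) : ℕ → (ℝ → E) → Prop
  | 0, f => MemLp f r (volume.restrict (Ioo a b))
  | m + 1, f => MemLp f r (volume.restrict (Ioo a b)) ∧
      ∃ g : ℝ → E, HasWeakDeriv a b f g ∧ MemSobolev a b r m g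

/-! ### Curves on `[0, L]`, curvature and energies

A curve `[0, L] → ℝ²` is a function on `ℝ` of which only the values on `[0, L]` matter. -/

/-- The first derivative of a curve on `[0, L]` (one-sided at the endpoints). -/
def velocity (L : ℝ) (γ : ℝ → Plane) : ℝ → Plane :=
  derivWithin γ (Icc 0 L)

/-- The second derivative of a curve on `[0, L]` (one-sided at the endpoints). If `γ` is the
continuous representative of a `W^{2,p}` curve, then it exists a.e. and agrees a.e. with the weak
second derivative. -/
def acceleration (L : ℝ) (γ : ℝ → Plane) : ℝ → Plane :=
  derivWithin (velocity L γ) (Icc 0 L)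

/-- The counterclockwise signed curvature `det (γ', γ'') / |γ'|^3`. -/
def signedCurvature (L : ℝ) (γ : ℝ → Plane) (t : ℝ) : ℝ :=
  (velocity L γ t 0 * acceleration L γ t 1 - velocity L γ t 1 * acceleration L γ t 0) /
    ‖velocity L γ t‖ ^ 3

/-- The `p`-bending energy `∫ |k|^p ds`. -/
def bendingEnergy (p L : ℝ) (γ : ℝ → Plane) : ℝ :=
  ∫ t in Ioo 0 L, |signedCurvature L γ t| ^ p * ‖velocity L γ t‖

/-- The length `∫ ds`. -/
def curveLength (L : ℝ) (γ : ℝ → Plane) : ℝ :=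
  ∫ t in Ioo 0 L, ‖velocity L γ t‖

/-- `γ` is (the continuous representative of) an immersed curve of class `W^{2,p}(0,L;ℝ²)`. -/
def IsImmersedW2p (p L : ℝ) (γ : ℝ → Plane) : Prop :=
  ContinuousOn γ (Icc 0 L) ∧ MemSobolev 0 L (ENNReal.ofReal p) 2 γ ∧
    ∀ t ∈ Icc 0 L, velocity L γ t ≠ 0

/-- `γ : [0, L] → ℝ²` is a `p`-elastica: for some multiplier `lam` it is a critical point of
`bendingEnergy + lam * curveLength` under smooth compactly supported perturbations. -/
def IsPElastica (p L : ℝ) (γ : ℝ → Plane) : Prop :=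
  IsImmersedW2p p L γ ∧
  ∃ lam : ℝ, ∀ η : ℝ → Plane, ContDiff ℝ ∞ η → HasCompactSupport η → tsupport η ⊆ Ioo 0 L →
    HasDerivAt (fun ε : ℝ =>
      bendingEnergy p L (fun t => γ t + ε • η t)
        + lam * curveLength L (fun t => γ t + ε • η t)) 0 0

/-- `γ : [0, L] → ℝ²` is parameterized by arclength. -/
def IsArclength (L : ℝ) (γ : ℝ → Plane) : Prop :=
  ∀ s ∈ Icc 0 L, ‖velocity L γ s‖ = 1

/-- The zero set `Z` of the signed curvature in `[0, L]`. -/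
def curvatureZeroSet (L : ℝ) (γ : ℝ → Plane) : Set ℝ :=
  {s ∈ Icc 0 L | signedCurvature L γ s = 0}

/-! ### `p`-elliptic integrals and functions, for `1 < p ≤ 2` and `0 ≤ q ≤ 1` -/

/-- Incomplete `p`-elliptic integral of the first kind `F_{1,p}(x,q)`
(for `q = 1` the integrand is `|cos θ|^{-2/p}` off the zeros of `cos`). -/
def F1 (p q x : ℝ) : ℝ :=
  ∫ θ in (0 : ℝ)..x, |Real.cos θ| ^ (1 - 2 / p) / Real.sqrt (1 - q ^ 2 * Real.sin θ ^ 2)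

/-- Incomplete `p`-elliptic integral of the first kind `F_{2,p}(x,q)`. -/
def F2 (p q x : ℝ) : ℝ :=
  ∫ θ in (0 : ℝ)..x, 1 / (1 - q ^ 2 * Real.sin θ ^ 2) ^ (1 / p)

/-- Incomplete `p`-elliptic integral of the second kind `E_{1,p}(x,q)`. -/
def E1 (p q x : ℝ) : ℝ :=
  ∫ θ in (0 : ℝ)..x, Real.sqrt (1 - q ^ 2 * Real.sin θ ^ 2) * |Real.cos θ| ^ (1 - 2 / p)

/-- Incomplete `p`-elliptic integral of the second kind `E_{2,p}(x,q)`. -/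
def E2 (p q x : ℝ) : ℝ :=
  ∫ θ in (0 : ℝ)..x, (1 - q ^ 2 * Real.sin θ ^ 2) ^ (1 / p)

/-- The domain on which the integrals of the first kind are increasing bijections onto `ℝ`,
for `1 < p ≤ 2`: the whole line if `q < 1`, the interval `(-π/2, π/2)` if `q = 1`. -/
def amplitudeDomain (q : ℝ) : Set ℝ :=
  if q = 1 then Ioo (-(Real.pi / 2)) (Real.pi / 2) else univ

/-- The amplitude function `am_{1,p}(·,q)`, the inverse of `F_{1,p}(·,q)`. -/
def am1 (p q : ℝ) : ℝ → ℝ :=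
  Function.invFunOn (F1 p q) (amplitudeDomain q)

/-- The amplitude function `am_{2,p}(·,q)`, the inverse of `F_{2,p}(·,q)`. -/
def am2 (p q : ℝ) : ℝ → ℝ :=
  Function.invFunOn (F2 p q) (amplitudeDomain q)

/-- The `p`-elliptic cosine `cn_p(·,q)`. -/
def cn (p q x : ℝ) : ℝ :=
  |Real.cos (am1 p q x)| ^ (2 / p - 1) * Real.cos (am1 p q x)

/-- The `p`-delta amplitude `dn_p(·,q)`. -/
def dn (p q x : ℝ) : ℝ :=
  (1 - q ^ 2 * Real.sin (am2 p q x) ^ 2) ^ (1 / p)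

/-- The `p`-hyperbolic secant `sech_p = cn_p(·,1)` (for `1 < p ≤ 2`). -/
def sech (p x : ℝ) : ℝ := cn p 1 x

/-- The `p`-hyperbolic tangent `tanh_p`. -/
def tanh (p x : ℝ) : ℝ :=
  ∫ t in (0 : ℝ)..x, sech p t ^ p

/-! ### The profile curves -/

/-- The linear profile curve. -/
def linearProfile (s : ℝ) : Plane := !₂[s, 0]

/-- The wavelike profile curve of modulus `q`. -/
def wavelikeProfile (p q s : ℝ) : Plane :=
  !₂[2 * E1 p q (am1 p q s) - s,
     -(q * (p / (p - 1)) * (|cn p q s| ^ (p - 2) * cn p q s))]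

/-- The borderline profile curve. -/
def borderlineProfile (p s : ℝ) : Plane :=
  !₂[2 * tanh p s - s, -(p / (p - 1) * sech p s ^ (p - 1))]

/-- The orbitlike profile curve of modulus `q`. -/
def orbitlikeProfile (p q s : ℝ) : Plane :=
  (1 / q ^ 2) • !₂[2 * E2 (p / (p - 1)) q (am2 p q s) + (q ^ 2 - 2) * s,
     -(p / (p - 1) * dn p q s ^ (p - 1))]

/-- The circular profile curve. -/
def circularProfile (s : ℝ) : Plane := !₂[Real.cos s, Real.sin s]

/-- Up to similarity (dilation by `c`, linear isometry `U`, translation by `v`) and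
reparameterization, `γ : [0, L] → ℝ²` is a part of the curve `Γ : ℝ → ℝ²`. The shift of the
parameter of `Γ` is included in the change of parameter `φ`, a `C¹` function on `[0, L]` with
nowhere vanishing derivative. -/
def IsRepresentedBy (L : ℝ) (γ Γ : ℝ → Plane) : Prop :=
  ∃ (c : ℝ) (U : Plane ≃ₗᵢ[ℝ] Plane) (v : Plane) (φ : ℝ → ℝ),
    0 < c ∧ ContDiffOn ℝ 1 φ (Icc 0 L) ∧
    (∀ s ∈ Icc 0 L, derivWithin φ (Icc 0 L) s ≠ 0) ∧
    ∀ s ∈ Icc 0 L, γ s = c • U (Γ (φ s)) + v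

def IsLinear (L : ℝ) (γ : ℝ → Plane) : Prop :=
  IsRepresentedBy L γ linearProfile

def IsWavelike (p L : ℝ) (γ : ℝ → Plane) : Prop :=
  ∃ q ∈ Ioo (0 : ℝ) 1, IsRepresentedBy L γ (wavelikeProfile p q)

def IsBorderline (p L : ℝ) (γ : ℝ → Plane) : Prop :=
  IsRepresentedBy L γ (borderlineProfile p)

def IsOrbitlike (p L : ℝ) (γ : ℝ → Plane) : Prop :=
  ∃ q ∈ Ioo (0 : ℝ) 1, IsRepresentedBy L γ (orbitlikeProfile p q)

def IsCircular (L : ℝ) (γ : ℝ → Plane) : Prop :=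
  IsRepresentedBy L γ circularProfile

/-! ### The regularity exponents -/

/-- `m_p = ⌈1/(p-1)⌉`. -/
def mExp (p : ℝ) : ℕ := ⌈1 / (p - 1)⌉₊

/-- `r_p = (m_p - 1/(p-1))⁻¹` (meaningful when `1/(p-1)` is not an integer). -/
def rExp (p : ℝ) : ℝ := ((mExp p : ℝ) - 1 / (p - 1))⁻¹

end PElastica

end

noncomputable section

namespace PElastica

open Filter Topology

/-! ### Analyticity of solutions of scalar equations -/

/-! Every profile has unit speed, so if a curve parameterized by arclength is represented by it, the
change of parameter is affine (`IsRepresentedBy.exists_affine`). Regularity of `γ` is thus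
regularity of the explicit profile on an interval.

For lines and circles the tangent is plainly analytic. For orbitlike and borderline profiles the
tangent angle is twice the amplitude, and the amplitude solves `f' = G(f)` with `G` analytic and
non-zero along the solution, so it is analytic by separation of variables
(`analyticAt_of_autonomous`).

In the wavelike case this equation degenerates for `p < 2` where the cosine of the amplitude
vanishes, that is, at the zeros of the curvature. The remedy is to use the height `Y` of the profile
instead. Put `a = 1/(p-1)`. The curvature is a constant times `sgn(Y)|Y|^a`
(`signPow_wavelikeHeight`), so the unit tangent `T` satisfies `T' = κ sgn(Y)|Y|^a J T` with `J` the
quarter turn, and `Y' ≠ 0` wherever `Y = 0`.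

If `a` is an odd integer, the squared cosine is an even power of `Y` up to a constant; near a zero,
`Y' = G(Y)` with `G` analytic and `G(0) ≠ 0`, and analyticity returns.

In general write `m_p = n + 1` and `b = a - n`, so `0 < b ≤ 1`. Bootstrapping gives class `C^(n+2)`,
and discarding `C^1` terms from the Leibniz and chain rules gives `γ^(n+2) = sgn(w)^(n+1) |w|^b V +
R`, where `w` is the height along `γ`, `V` and `R` are `C^1`, and `V ≠ 0`, `w' ≠ 0` at the zeros of
`w` (`IsWavelike.exists_iteratedDeriv_eq`). The next weak derivative behaves like `|w|^(b-1)`. For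
`b < 1` it lies in `L^r` for `r < 1/(1-b) = r_p`, but at `r_p` its power dominates a multiple of
`1/|x-s|` at a zero `s` (`memLp_abs_rpow`, `not_memLp_powDeriv`). For `b = 1` it is bounded, and if
`a` is even it jumps at an interior zero, so it has no weak derivative
(`not_hasWeakDeriv_powDeriv_one`). -/

lemma exists_analyticAt_primitive {g : ℝ → ℝ} {x : ℝ} (hg : AnalyticAt ℝ g x) :
    ∃ Q : ℝ → ℝ, AnalyticAt ℝ Q x ∧ ∀ᶠ y in 𝓝 x, HasDerivAt Q (g y) y := by
  obtain ⟨p, hp⟩ := hg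
  -- Coefficients of the termwise antiderivative; dividing by `k + 1` can only decrease them, so the
  -- radius of convergence stays positive.
  set b : ℕ → ℝ := fun n => match n with
    | 0 => 0
    | k + 1 => p.coeff k / (k + 1) with hb
  set q : FormalMultilinearSeries ℝ ℝ ℝ := fun n => ContinuousMultilinearMap.mkPiRing ℝ (Fin n) (b n)
    with hq
  have hqc : ∀ n, q.coeff n = b n := fun n => by
    simp [FormalMultilinearSeries.coeff, hq]
  obtain ⟨C, R, hC, hR, hpR⟩ := p.le_mul_pow_of_radius_pos hp.radius_pos
  have hrad : 0 < q.radius := by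
    have h1 : (R⁻¹.toNNReal : ℝ≥0∞) ≤ q.radius := by
      refine q.le_radius_of_bound (C * R⁻¹) fun n => ?_
      rw [Real.coe_toNNReal _ (by positivity)]
      cases n with
      | zero => simp [hq, hb]; positivity
      | succ k =>
        have h2 : ‖q (k + 1)‖ ≤ C * R ^ k := by
          rw [FormalMultilinearSeries.norm_apply_eq_norm_coef, hqc]
          refine le_trans ?_ (hpR k)
          rw [FormalMultilinearSeries.norm_apply_eq_norm_coef]
          simp only [hb, norm_div]
          apply div_le_self (norm_nonneg _)
          rw [Real.norm_of_nonneg (by positivity)]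
          have : (0 : ℝ) ≤ k := k.cast_nonneg
          linarith
        calc ‖q (k + 1)‖ * R⁻¹ ^ (k + 1) ≤ C * R ^ k * R⁻¹ ^ (k + 1) := by gcongr
          _ = C * R⁻¹ := by rw [pow_succ, inv_pow]; field_simp
    refine lt_of_lt_of_le ?_ h1
    rw [ENNReal.coe_pos, Real.toNNReal_pos]
    positivity
  have hball := q.hasFPowerSeriesOnBall hrad
  have hsub : Tendsto (fun y => y - x) (𝓝 x) (𝓝 0) := by
    have : ContinuousAt (fun y => y - x) x := by fun_prop
    simpa [ContinuousAt] using this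
  refine ⟨fun y => q.sum (y - x), ?_, ?_⟩
  · have h1 : AnalyticAt ℝ q.sum (x - x) := by simpa using hball.analyticAt
    exact AnalyticAt.comp (g := q.sum) (f := fun y => y - x) h1
      (analyticAt_id.sub analyticAt_const)
  · have h1 := hball.fderiv.hasFPowerSeriesAt
    rw [hasFPowerSeriesAt_iff] at h1
    have h2 := hasFPowerSeriesAt_iff.1 hp
    have h3 := hball.analyticAt.eventually_analyticAt
    have h4 : ∀ᶠ z in 𝓝 (0 : ℝ), HasDerivAt q.sum (g (x + z)) z := by
      filter_upwards [h1, h2, h3] with z h1 h2 h3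
      have h5 := ((ContinuousLinearMap.apply ℝ ℝ (1 : ℝ)).hasSum h1)
      have h6 : HasSum (fun n => z ^ n • p.coeff n) (fderiv ℝ q.sum (0 + z) 1) := by
        refine (h5.congr_fun ?_)
        intro n
        simp only [map_smul, ContinuousLinearMap.apply_apply,
          FormalMultilinearSeries.derivSeries_coeff_one, hqc, hb]
        simp only [nsmul_eq_mul, smul_eq_mul]
        push_cast
        field_simp
      have h7 := h6.unique h2
      rw [zero_add] at h7
      rw [← h7]
      exact h3.differentiableAt.hasDerivAt
    filter_upwards [hsub.eventually h4] with y hy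
    have := hy.comp y ((hasDerivAt_id y).sub_const x)
    simpa [Function.comp_def] using this

/-- On a small ball `f` differs by a constant from the analytic primitive of `g`. -/
lemma analyticAt_of_eventually_hasDerivAt {f g : ℝ → ℝ} {x : ℝ}
    (hf : ∀ᶠ y in 𝓝 x, HasDerivAt f (g y) y) (hg : AnalyticAt ℝ g x) : AnalyticAt ℝ f x := by
  obtain ⟨Q, hQ, hQ'⟩ := exists_analyticAt_primitive hg
  obtain ⟨ε, hε, h⟩ := Metric.eventually_nhds_iff_ball.1 (hf.and hQ')
  have hconst : ∀ y ∈ Metric.ball x ε, f y - Q y = f x - Q x := fun y hy =>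
    Metric.isOpen_ball.is_const_of_deriv_eq_zero
      (convex_ball x ε).isPreconnected
      (fun z hz => ((h z hz).1.sub (h z hz).2).differentiableAt.differentiableWithinAt)
      (fun z hz => by simpa using ((h z hz).1.sub (h z hz).2).deriv) hy (Metric.mem_ball_self hε)
  have h1 : AnalyticAt ℝ (fun y => Q y + (f x - Q x)) x := hQ.add analyticAt_const
  refine h1.congr ?_
  filter_upwards [Metric.ball_mem_nhds x hε] with y hy
  linarith [hconst y hy]

/-- Solutions of a scalar autonomous equation with analytic nonvanishing right-hand side are
analytic. -/
lemma analyticAt_of_autonomous {f G : ℝ → ℝ} {x : ℝ}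
    (hf : ∀ᶠ y in 𝓝 x, HasDerivAt f (G (f y)) y) (hG : AnalyticAt ℝ G (f x)) (h0 : G (f x) ≠ 0) :
    AnalyticAt ℝ f x := by
  -- Separation of variables: `H' = 1/G`, so `H ∘ f` has derivative `1` and is analytic; `f` is
  -- recovered through the analytic local inverse of `H`.
  obtain ⟨H, hH, hH'⟩ := exists_analyticAt_primitive (hG.inv h0)
  have hd : deriv H (f x) ≠ 0 := by
    rw [hH'.self_of_nhds.deriv]; exact inv_ne_zero h0
  have hfc : ContinuousAt f x := hf.self_of_nhds.continuousAt
  have hGf : ∀ᶠ y in 𝓝 x, G (f y) ≠ 0 := hfc.eventually (hG.continuousAt.eventually_ne h0)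
  have hcomp : AnalyticAt ℝ (H ∘ f) x := by
    refine analyticAt_of_eventually_hasDerivAt (g := fun _ => 1) ?_ analyticAt_const
    filter_upwards [hf, hGf, hfc.eventually hH'] with y h1 h2 h3
    have := h3.comp y h1
    simpa [inv_mul_cancel₀ h2] using this
  have hinv := hH.analyticAt_localInverse hd
  have h2 : AnalyticAt ℝ (hH.hasStrictDerivAt.localInverse _ _ _ hd ∘ (H ∘ f)) x :=
    AnalyticAt.comp hinv hcomp
  refine h2.congr ?_
  filter_upwards [hfc.eventually (hH.hasStrictDerivAt.eventually_left_inverse hd)] with y hy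
  exact hy

/-! ### Calculus lemmas -/

/-- The fundamental theorem of calculus tolerates a countable exceptional set, so `f` is a primitive
of the continuous `g`. This carries derivative formulas across the zeros of the cosine, where the
integrands are singular. -/
lemma hasDerivAt_of_off_countable {E : Type*} [NormedAddCommGroup E] [NormedSpace ℝ E]
    [CompleteSpace E] {f g : ℝ → E} {s : Set ℝ} (hs : s.Countable) (hf : Continuous f)
    (hg : Continuous g) (h : ∀ x, x ∉ s → HasDerivAt f (g x) x) (x : ℝ) : HasDerivAt f (g x) x := by
  have key : f = fun y => f 0 + ∫ t in (0 : ℝ)..y, g t := by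
    funext y
    rw [MeasureTheory.integral_eq_of_hasDerivAt_off_countable f g hs hf.continuousOn
      (fun z hz => h z hz.2) (hg.intervalIntegrable _ _)]
    abel
  rw [key]
  exact (hg.integral_hasStrictDerivAt 0 x).hasDerivAt.const_add _

lemma exists_mul_abs_le_of_hasDerivAt {w : ℝ → ℝ} {w' s : ℝ} (h0 : w s = 0) (h : HasDerivAt w w' s)
    (hw : w' ≠ 0) : ∃ c > 0, ∀ᶠ x in 𝓝 s, c * |x - s| ≤ |w x| := by
  refine ⟨|w'| / 2, by positivity, ?_⟩
  have h1 := (hasDerivAt_iff_isLittleO.1 h).def (show 0 < |w'| / 2 by positivity)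
  filter_upwards [h1] with x hx
  simp only [h0, sub_zero, smul_eq_mul, Real.norm_eq_abs] at hx
  have h2 := abs_sub_abs_le_abs_sub ((x - s) * w') (w x)
  rw [abs_sub_comm ((x - s) * w'), abs_mul] at h2
  nlinarith

lemma exists_abs_le_mul_of_hasDerivAt {w : ℝ → ℝ} {w' s : ℝ} (h0 : w s = 0)
    (h : HasDerivAt w w' s) : ∃ c > 0, ∀ᶠ x in 𝓝 s, |w x| ≤ c * |x - s| := by
  refine ⟨|w'| + 1, by positivity, ?_⟩
  have h1 := (hasDerivAt_iff_isLittleO.1 h).def one_pos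
  filter_upwards [h1] with x hx
  simp only [h0, sub_zero, smul_eq_mul, Real.norm_eq_abs] at hx
  have h2 := abs_sub_abs_le_abs_sub (w x) ((x - s) * w')
  rw [abs_mul] at h2
  nlinarith

lemma locallyIntegrable_abs_sub_rpow {β : ℝ} (hβ : β < 1) (s : ℝ) :
    LocallyIntegrable (fun x => |x - s| ^ (-β)) := by
  have h1 : LocallyIntegrable (fun x : ℝ => |x| ^ (-β)) := by
    refine locallyIntegrable_of_norm_le_rpow (μ := (volume : Measure ℝ)) (C := 1) (α := β)
      (by simp) (by simpa using hβ) ?_ ?_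
    · refine Eventually.of_forall fun x => ?_
      rw [Real.norm_of_nonneg (by positivity), one_mul, Real.norm_eq_abs]
    · exact (Measurable.pow_const (by fun_prop) _).aestronglyMeasurable
  intro x
  obtain ⟨u, hu, hi⟩ := h1 (x - s)
  refine ⟨(fun y => y - s) ⁻¹' u, ?_, ?_⟩
  · exact (continuous_sub_right s).continuousAt hu
  · have := (measurePreserving_sub_right (volume : Measure ℝ) s).integrableOn_comp_preimage
      (MeasurableEquiv.subRight s).measurableEmbedding (f := fun x : ℝ => |x| ^ (-β)) (s := u)
    exact this.2 hi

/-- A negative power of exponent greater than `-1` of a function with only simple zeros is locally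
integrable. -/
lemma locallyIntegrable_abs_rpow_of_simple_zeros {w : ℝ → ℝ} (hc : Continuous w)
    (hw : ∀ s, w s = 0 → ∃ w', w' ≠ 0 ∧ HasDerivAt w w' s) {β : ℝ} (hβ0 : 0 ≤ β) (hβ : β < 1) :
    LocallyIntegrable (fun x => |w x| ^ (-β)) := by
  have hm : Measurable (fun x => |w x| ^ (-β)) := Measurable.pow_const (by fun_prop) _
  intro s
  by_cases h0 : w s = 0
  · obtain ⟨w', hw', hd⟩ := hw s h0
    obtain ⟨c, hc0, hc1⟩ := exists_mul_abs_le_of_hasDerivAt h0 hd hw'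
    refine Asymptotics.IsBigO.integrableAtFilter (g := fun x => |x - s| ^ (-β)) ?_
      hm.stronglyMeasurable.stronglyMeasurableAtFilter (locallyIntegrable_abs_sub_rpow hβ s s)
    refine Asymptotics.IsBigO.of_bound (c ^ (-β) + 1) ?_
    filter_upwards [hc1] with x hx
    rw [Real.norm_of_nonneg (by positivity), Real.norm_of_nonneg (by positivity)]
    have hn : 0 ≤ |x - s| ^ (-β) := by positivity
    -- At the zero itself both sides contain the same default value `0 ^ (-β)`; the `+ 1` in the
    -- constant lets the bound hold there without computing it.
    rcases eq_or_ne x s with rfl | hxs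
    · have : 0 ≤ c ^ (-β) := by positivity
      rw [h0, sub_self]
      rw [sub_self] at hn
      nlinarith
    · have hpos : 0 < |x - s| := abs_pos.2 (sub_ne_zero.2 hxs)
      calc |w x| ^ (-β) ≤ (c * |x - s|) ^ (-β) :=
            Real.rpow_le_rpow_of_nonpos (by positivity) hx (by linarith)
        _ = c ^ (-β) * |x - s| ^ (-β) := Real.mul_rpow hc0.le hpos.le
        _ ≤ _ := by nlinarith
  · have : ContinuousAt (fun x => |w x| ^ (-β)) s := by
      apply ContinuousAt.rpow_const
      · fun_prop
      · left; simpa using h0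
    exact (this.isBigO_one ℝ).integrableAtFilter hm.stronglyMeasurable.stronglyMeasurableAtFilter
      (locallyIntegrable_const (1 : ℝ) s)

/-! ### Weak derivatives and Sobolev functions -/

section Sobolev

variable {E : Type*} [NormedAddCommGroup E] [NormedSpace ℝ E] {a b : ℝ} {r : ℝ≥0∞} {m n : ℕ}
  {f g f₁ g₁ : ℝ → E}

lemma HasWeakDeriv.congr (h : HasWeakDeriv a b f g) (hf : f =ᵐ[volume.restrict (Ioo a b)] f₁)
    (hg : g =ᵐ[volume.restrict (Ioo a b)] g₁) : HasWeakDeriv a b f₁ g₁ := by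
  refine ⟨h.1.congr hf, h.2.1.congr hg, fun φ h1 h2 h3 => ?_⟩
  rw [← integral_congr_ae (hf.mono fun x hx => show deriv φ x • f x = deriv φ x • f₁ x by rw [hx]),
    ← integral_congr_ae (hg.mono fun x hx => show φ x • g x = φ x • g₁ x by rw [hx])]
  exact h.2.2 φ h1 h2 h3

lemma MemSobolev.congr (h : MemSobolev a b r m f) (hf : f =ᵐ[volume.restrict (Ioo a b)] f₁) :
    MemSobolev a b r m f₁ := by
  cases m with
  | zero => exact MemLp.ae_eq hf h
  | succ m =>
    obtain ⟨h1, g, hg, h2⟩ := h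
    exact ⟨h1.ae_eq hf, g, hg.congr hf EventuallyEq.rfl, h2⟩

lemma integrable_smul_of_tsupport_subset (hg : LocallyIntegrableOn g (Ioo a b)) {φ : ℝ → ℝ}
    (hφ : Continuous φ) (hc : HasCompactSupport φ) (hs : tsupport φ ⊆ Ioo a b) :
    Integrable (fun x => φ x • g x) := by
  have h1 : IntegrableOn g (tsupport φ) := hg.integrableOn_compact_subset hs hc
  have h2 : IntegrableOn (fun x => φ x • g x) (tsupport φ) :=
    h1.continuousOn_smul hφ.continuousOn hc
  rwa [integrableOn_iff_integrable_of_support_subset] at h2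
  exact (Function.support_smul_subset_left φ g).trans (subset_tsupport φ)

lemma setIntegral_smul_of_tsupport_subset {φ : ℝ → ℝ} (hs : tsupport φ ⊆ Ioo a b) :
    ∫ x in Ioo a b, φ x • g x = ∫ x, φ x • g x := by
  refine setIntegral_eq_integral_of_forall_compl_eq_zero fun x hx => ?_
  rw [image_eq_zero_of_notMem_tsupport fun h => hx (hs h), zero_smul]

/-- The difference integrates to zero against every test function, so the fundamental lemma of the
calculus of variations applies. -/
lemma HasWeakDeriv.unique [CompleteSpace E] (h : HasWeakDeriv a b f g) (h₁ : HasWeakDeriv a b f g₁) :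
    g =ᵐ[volume.restrict (Ioo a b)] g₁ := by
  have key := isOpen_Ioo.ae_eq_zero_of_integral_contDiff_smul_eq_zero
    (h.2.1.sub h₁.2.1) (fun φ h1 h2 h3 => ?_)
  · rw [EventuallyEq, ae_restrict_iff' measurableSet_Ioo]
    filter_upwards [key] with x hx hx'
    exact sub_eq_zero.1 (hx hx')
  · have e1 := h.2.2 φ h1 h2 h3
    have e2 := h₁.2.2 φ h1 h2 h3
    rw [e1, neg_inj, setIntegral_smul_of_tsupport_subset h3,
      setIntegral_smul_of_tsupport_subset h3] at e2
    simp only [Pi.sub_apply, smul_sub]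
    rw [integral_sub (integrable_smul_of_tsupport_subset h.2.1 h1.continuous h2 h3)
      (integrable_smul_of_tsupport_subset h₁.2.1 h1.continuous h2 h3), e2, sub_self]

/-- The product `φ f` is continuous, vanishes at the endpoints and has an integrable derivative off
a countable set, so that derivative has integral zero. Continuity of `f` is what excludes jumps; `g`
may be unbounded. -/
lemma hasWeakDeriv_of_hasDerivAt_off_countable [CompleteSpace E] {s : Set ℝ} (hs : s.Countable)
    (hf : Continuous f) (hd : ∀ x, x ∉ s → HasDerivAt f (g x) x) (hg : LocallyIntegrable g) :
    HasWeakDeriv a b f g := by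
  refine ⟨hf.locallyIntegrable.locallyIntegrableOn _, hg.locallyIntegrableOn _,
    fun φ h1 h2 h3 => ?_⟩
  have hφ' : Continuous (deriv φ) := h1.continuous_deriv (by simp)
  have h3' : tsupport (deriv φ) ⊆ Ioo a b := (tsupport_deriv_subset).trans h3
  have i1 := integrable_smul_of_tsupport_subset (hf.locallyIntegrable.locallyIntegrableOn _) hφ'
    h2.deriv h3'
  have i2 := integrable_smul_of_tsupport_subset (hg.locallyIntegrableOn _) h1.continuous h2 h3
  rw [eq_neg_iff_add_eq_zero, setIntegral_smul_of_tsupport_subset h3,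
    setIntegral_smul_of_tsupport_subset h3', ← integral_add i1 i2]
  rcases lt_or_ge a b with hab | hab
  swap
  · have : φ = 0 := by
      rw [Ioo_eq_empty_of_le hab, subset_empty_iff, tsupport_eq_empty_iff] at h3
      exact h3
    simp [this]
  have hz : ∀ x, x ∉ Ioc a b → deriv φ x • f x + φ x • g x = 0 := fun x hx => by
    have hx' : x ∉ Ioo a b := fun h => hx (Ioo_subset_Ioc_self h)
    rw [image_eq_zero_of_notMem_tsupport fun h => hx' (h3 h),
      image_eq_zero_of_notMem_tsupport fun h => hx' (h3' h)]
    simp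
  rw [← setIntegral_eq_integral_of_forall_compl_eq_zero hz,
    ← intervalIntegral.integral_of_le hab.le,
    integral_eq_of_hasDerivAt_off_countable_of_le (fun x => φ x • f x)
      (fun x => deriv φ x • f x + φ x • g x) hab.le hs
      (h1.continuous.smul hf).continuousOn ?_ (i1.add i2).intervalIntegrable]
  · rw [image_eq_zero_of_notMem_tsupport (x := b) fun h => (h3 h).2.false,
      image_eq_zero_of_notMem_tsupport (x := a) fun h => (h3 h).1.false]
    simp
  · intro x hx
    have := ((h1.differentiable (by simp)) x).hasDerivAt.smul (hd x hx.2)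
    rw [add_comm]
    exact this

omit [NormedSpace ℝ E] in
lemma memLp_Ioo_of_continuous (hf : Continuous f) : MemLp f r (volume.restrict (Ioo a b)) := by
  obtain ⟨C, hC⟩ := isCompact_Icc.exists_bound_of_continuousOn (s := Icc a b) hf.continuousOn
  refine MemLp.of_bound hf.aestronglyMeasurable C ?_
  rw [ae_restrict_iff' measurableSet_Ioo]
  exact Eventually.of_forall fun x hx => hC x (Ioo_subset_Icc_self hx)

lemma hasWeakDeriv_deriv [CompleteSpace E] (hf : ContDiff ℝ 1 f) :
    HasWeakDeriv a b f (deriv f) :=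
  hasWeakDeriv_of_hasDerivAt_off_countable countable_empty hf.continuous
    (fun x _ => (hf.differentiable (by simp) x).hasDerivAt)
    (hf.continuous_deriv le_rfl).locallyIntegrable

lemma ContDiff.deriv_of_succ (hf : ContDiff ℝ (n + 1) f) : ContDiff ℝ n (deriv f) :=
  (contDiff_succ_iff_deriv.1 hf).2.2

/-- For a function of class `C^n`, belonging to `W^{n+k,r}` is a condition on the `n`-th
derivative. -/
lemma memSobolev_add_iff [CompleteSpace E] (k : ℕ) (hf : ContDiff ℝ n f) :
    MemSobolev a b r (k + n) f ↔ MemSobolev a b r k (iteratedDeriv n f) := by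
  induction n generalizing f with
  | zero => simp
  | succ n ih =>
    have h1 : ContDiff ℝ 1 f := hf.of_le (by norm_cast; omega)
    have hf' : ContDiff ℝ n (deriv f) := ContDiff.deriv_of_succ (by exact_mod_cast hf)
    rw [iteratedDeriv_succ', ← ih hf', ← add_assoc]
    constructor
    · rintro ⟨-, g, hg, h2⟩
      exact h2.congr (hg.unique (hasWeakDeriv_deriv h1))
    · exact fun h => ⟨memLp_Ioo_of_continuous hf.continuous, _, hasWeakDeriv_deriv h1, h⟩

/-- A weakly differentiable function has no jumps. -/
lemma HasWeakDeriv.eq_of_tendsto [CompleteSpace E] (h : HasWeakDeriv a b f g)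
    (hm : StronglyMeasurable f) {s : ℝ} (hs : s ∈ Ioo a b) {y z : E}
    (hy : Tendsto f (𝓝[<] s) (𝓝 y)) (hz : Tendsto f (𝓝[>] s) (𝓝 z)) : y = z := by
  -- Test against `φ((x - s)/ε)` as `ε → 0`. After rescaling, the side with `φ'` tends to `y - z`,
  -- because `φ'` has integral `1` over the negative and `-1` over the positive half-line. The side
  -- with `g` tends to `0`, because the supports shrink to a point.
  let φ : ContDiffBump (0 : ℝ) := ⟨1, 2, one_pos, one_lt_two⟩
  have hφs : tsupport φ = Metric.closedBall 0 2 := φ.tsupport_eq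
  have hφc : HasCompactSupport φ := φ.hasCompactSupport
  have hφd : ContDiff ℝ ∞ φ := φ.contDiff
  have hφ0 : φ 0 = 1 := φ.one_of_mem_closedBall (by simp [φ])
  have hφ' : Continuous (deriv φ) := hφd.continuous_deriv (by simp)
  have hz' : ∀ u : ℝ, 2 < |u| → φ u = 0 := fun u hu =>
    image_eq_zero_of_notMem_tsupport (by rw [hφs]; simpa using hu)
  have hdz : ∀ u : ℝ, 2 < |u| → deriv φ u = 0 := fun u hu =>
    image_eq_zero_of_notMem_tsupport fun h' => by
      have := tsupport_deriv_subset h'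
      rw [hφs] at this
      simp at this
      linarith
  obtain ⟨δ, hδ, hball⟩ := Metric.isOpen_iff.1 isOpen_Ioo s hs
  -- the rescaled identity
  have hid : ∀ ε : ℝ, 0 < ε → 2 * ε < δ →
      Integrable (fun x => φ (ε⁻¹ * (x - s)) • g x) ∧
      ∫ u, deriv φ u • f (s + ε * u) = - ∫ x, φ (ε⁻¹ * (x - s)) • g x := by
    intro ε hε hεδ
    set ψ : ℝ → ℝ := fun x => φ (ε⁻¹ * (x - s)) with hψ
    have hsupp : tsupport ψ ⊆ Metric.closedBall s (2 * ε) := by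
      refine closure_minimal (fun x hx => ?_) Metric.isClosed_closedBall
      by_contra hx'
      refine hx (hz' _ ?_)
      rw [Metric.mem_closedBall, Real.dist_eq, not_le] at hx'
      rw [abs_mul, abs_of_pos (inv_pos.2 hε), lt_inv_mul_iff₀ hε]
      linarith
    have hsub : tsupport ψ ⊆ Ioo a b := fun x hx => hball <| by
      have := hsupp hx
      rw [Metric.mem_closedBall] at this
      rw [Metric.mem_ball]
      linarith
    have hψd : ContDiff ℝ ∞ ψ := hφd.comp (by fun_prop)
    have hψc : HasCompactSupport ψ :=
      (isCompact_closedBall s (2 * ε)).of_isClosed_subset (isClosed_tsupport ψ) hsupp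
    have hderiv : ∀ x, deriv ψ x = ε⁻¹ * deriv φ (ε⁻¹ * (x - s)) := fun x => by
      have h1 : HasDerivAt (fun x : ℝ => ε⁻¹ * (x - s)) ε⁻¹ x := by
        simpa using ((hasDerivAt_id x).sub_const s).const_mul ε⁻¹
      have h2 := ((hφd.differentiable (by simp)) (ε⁻¹ * (x - s))).hasDerivAt.comp x h1
      rw [mul_comm]
      exact h2.deriv
    refine ⟨integrable_smul_of_tsupport_subset h.2.1 hψd.continuous hψc hsub, ?_⟩
    have e := h.2.2 ψ hψd hψc hsub
    rw [setIntegral_smul_of_tsupport_subset hsub,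
      setIntegral_smul_of_tsupport_subset ((tsupport_deriv_subset).trans hsub)] at e
    rw [← e]
    have e1 := Measure.integral_comp_mul_left (fun v => deriv φ (ε⁻¹ * v) • f (s + v)) ε
    have e2 := integral_add_left_eq_self (μ := (volume : Measure ℝ))
      (fun x => deriv φ (ε⁻¹ * (x - s)) • f x) s
    simp only [add_sub_cancel_left] at e2
    rw [e2] at e1
    simp only [inv_mul_cancel_left₀ hε.ne'] at e1
    rw [e1, abs_of_pos (inv_pos.2 hε), ← integral_smul]
    simp only [hderiv, smul_smul]
  -- limit of the right-hand side
  have hR : Tendsto (fun ε : ℝ => - ∫ x, φ (ε⁻¹ * (x - s)) • g x) (𝓝[>] 0) (𝓝 0) := by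
    have hK : IntegrableOn g (Metric.closedBall s (δ / 2)) :=
      h.2.1.integrableOn_compact_subset
        ((Metric.closedBall_subset_ball (by linarith)).trans hball) (isCompact_closedBall _ _)
    have h1 : ∀ᶠ ε : ℝ in 𝓝[>] 0, ε < δ / 4 :=
      mem_nhdsWithin_of_mem_nhds (Iio_mem_nhds (by positivity))
    have hfar : ∀ ε : ℝ, 0 < ε → ∀ x, 2 * ε < |x - s| → φ (ε⁻¹ * (x - s)) = 0 :=
      fun ε hε x hx => hz' _ <| by
        rw [abs_mul, abs_of_pos (inv_pos.2 hε), lt_inv_mul_iff₀ hε]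
        linarith
    have hlim := tendsto_integral_filter_of_dominated_convergence (μ := (volume : Measure ℝ))
      (l := 𝓝[>] (0 : ℝ)) (F := fun ε x => φ (ε⁻¹ * (x - s)) • g x) (f := fun _ => (0 : E))
      ((Metric.closedBall s (δ / 2)).indicator fun x => ‖g x‖) ?_ ?_ ?_ ?_
    · simpa using hlim.neg
    · filter_upwards [h1, self_mem_nhdsWithin] with ε h1 h2
      exact (hid ε h2 (by linarith)).1.aestronglyMeasurable
    · filter_upwards [h1, self_mem_nhdsWithin] with ε h1 h2
      refine Eventually.of_forall fun x => ?_
      by_cases hx : x ∈ Metric.closedBall s (δ / 2)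
      · rw [indicator_of_mem hx, norm_smul, Real.norm_of_nonneg φ.nonneg]
        exact mul_le_of_le_one_left (norm_nonneg _) φ.le_one
      · rw [indicator_of_notMem hx, hfar ε h2, zero_smul, norm_zero]
        rw [Metric.mem_closedBall, Real.dist_eq] at hx
        linarith
    · exact (integrable_indicator_iff Metric.isClosed_closedBall.measurableSet).2 hK.norm
    · have hne : ∀ᵐ x : ℝ, x ≠ s := by simp [ae_iff]
      filter_upwards [hne] with x hx
      have hpos : 0 < |x - s| := abs_pos.2 (sub_ne_zero.2 hx)
      have h2 : ∀ᶠ ε : ℝ in 𝓝[>] 0, ε < |x - s| / 2 :=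
        mem_nhdsWithin_of_mem_nhds (Iio_mem_nhds (by positivity))
      refine tendsto_const_nhds.congr' ?_
      filter_upwards [h2, self_mem_nhdsWithin] with ε h2 h3
      rw [hfar ε h3 x (by linarith), zero_smul]
  have hL : Tendsto (fun ε : ℝ => ∫ u, deriv φ u • f (s + ε * u)) (𝓝[>] 0) (𝓝 (y - z)) := by
    obtain ⟨M, hM⟩ : ∃ M, ∀ᶠ x in 𝓝[≠] s, ‖f x‖ ≤ M := by
      refine ⟨max (‖y‖ + 1) (‖z‖ + 1), ?_⟩
      rw [← Iio_union_Ioi, nhdsWithin_union, eventually_sup]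
      constructor
      · filter_upwards [hy.norm.eventually (gt_mem_nhds (lt_add_one ‖y‖))] with x hx
        exact hx.le.trans (le_max_left _ _)
      · filter_upwards [hz.norm.eventually (gt_mem_nhds (lt_add_one ‖z‖))] with x hx
        exact hx.le.trans (le_max_right _ _)
    obtain ⟨η, hη, hM⟩ := Metric.mem_nhdsWithin_iff.1 hM
    have h1 : ∀ᶠ ε : ℝ in 𝓝[>] 0, ε < η / 2 :=
      mem_nhdsWithin_of_mem_nhds (Iio_mem_nhds (by positivity))
    have hne : ∀ᵐ u : ℝ, u ≠ 0 := by simp [ae_iff]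
    have hto : ∀ u : ℝ, Tendsto (fun ε : ℝ => s + ε * u) (𝓝[>] 0) (𝓝 s) := fun u => by
      have : Continuous fun ε : ℝ => s + ε * u := by fun_prop
      simpa using (this.tendsto 0).mono_left nhdsWithin_le_nhds
    have hlim := tendsto_integral_filter_of_dominated_convergence (μ := (volume : Measure ℝ))
      (l := 𝓝[>] (0 : ℝ)) (F := fun ε u => deriv φ u • f (s + ε * u))
      (f := fun u => deriv φ u • (if u < 0 then y else z)) (fun u => ‖deriv φ u‖ * M)
      ?_ ?_ ?_ ?_
    · have hi : Integrable (deriv φ) := hφ'.integrable_of_hasCompactSupport hφc.deriv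
      have hint : Integrable fun u => deriv φ u • (if u < 0 then y else z) := by
        refine (((hi.smul_const y).indicator (measurableSet_Iio (a := (0 : ℝ)))).add
          ((hi.smul_const z).indicator (measurableSet_Ici (a := (0 : ℝ))))).congr
          (Eventually.of_forall fun u => ?_)
        by_cases hu : u < 0
        · simp [hu]
        · simp [hu, not_lt.1 hu]
      have hval : ∫ u, deriv φ u • (if u < 0 then y else z) = y - z := by
        rw [← intervalIntegral.integral_Iic_add_Ioi (b := (0 : ℝ)), integral_Iic_eq_integral_Iio,
          setIntegral_congr_fun (g := fun u => deriv φ u • y) measurableSet_Iio,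
          setIntegral_congr_fun (g := fun u => deriv φ u • z) measurableSet_Ioi,
          integral_smul_const, integral_smul_const, ← integral_Iic_eq_integral_Iio,
          hφc.integral_Iic_deriv_eq (hφd.of_le (by simp)),
          hφc.integral_Ioi_deriv_eq (hφd.of_le (by simp)), hφ0]
        · module
        · intro u hu
          simp [not_lt.2 (le_of_lt (mem_Ioi.1 hu))]
        · intro u hu
          simp [mem_Iio.1 hu]
        · exact hint.integrableOn
        · exact hint.integrableOn
      rwa [hval] at hlim
    · refine Eventually.of_forall fun ε => ?_
      exact (hφ'.stronglyMeasurable.smul (hm.comp_measurable (by fun_prop))).aestronglyMeasurable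
    · filter_upwards [h1, self_mem_nhdsWithin] with ε h1 h2
      filter_upwards [hne] with u hu
      rw [norm_smul]
      by_cases hu2 : 2 < |u|
      · simp [hdz u hu2]
      · gcongr
        refine hM ⟨?_, ?_⟩
        · rw [Metric.mem_ball, Real.dist_eq, add_sub_cancel_left, abs_mul, abs_of_pos h2]
          have h2' : 0 < ε := h2
          nlinarith
        · simpa using ⟨(ne_of_gt h2), hu⟩
    · exact (hφ'.integrable_of_hasCompactSupport hφc.deriv).norm.mul_const M
    · filter_upwards [hne] with u hu
      refine Tendsto.const_smul ?_ _
      rcases lt_or_gt_of_ne hu with hu | hu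
      · rw [if_pos hu]
        refine hy.comp (tendsto_nhdsWithin_iff.2 ⟨hto u, ?_⟩)
        filter_upwards [self_mem_nhdsWithin] with ε hε
        have : 0 < ε := hε
        simp only [mem_Iio]
        nlinarith
      · rw [if_neg hu.le.not_gt]
        refine hz.comp (tendsto_nhdsWithin_iff.2 ⟨hto u, ?_⟩)
        filter_upwards [self_mem_nhdsWithin] with ε hε
        have : 0 < ε := hε
        simp only [mem_Ioi]
        nlinarith
  have := tendsto_nhds_unique (hL.congr' ?_) hR
  · exact sub_eq_zero.1 this
  · have h1 : ∀ᶠ ε : ℝ in 𝓝[>] 0, ε < δ / 2 := 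
      mem_nhdsWithin_of_mem_nhds (Iio_mem_nhds (by positivity))
    filter_upwards [h1, self_mem_nhdsWithin] with ε h1 h2
    exact (hid ε h2 (by linarith)).2

end Sobolev

/-! ### Powers with a sign -/

/-- The function `sgn(x)^k |x|^b`. -/
def signPow (k : ℕ) (b x : ℝ) : ℝ := (x / |x|) ^ k * |x| ^ b

lemma abs_signPow_le (k : ℕ) (b x : ℝ) : |signPow k b x| ≤ |x| ^ b := by
  rw [signPow, abs_mul, abs_of_nonneg (show 0 ≤ |x| ^ b by positivity), abs_pow, abs_div, abs_abs]
  exact mul_le_of_le_one_left (by positivity) (pow_le_one₀ (by positivity) (div_self_le_one _))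

lemma abs_signPow (k : ℕ) (b : ℝ) {x : ℝ} (hx : x ≠ 0) : |signPow k b x| = |x| ^ b := by
  rw [signPow, abs_mul, abs_of_nonneg (show 0 ≤ |x| ^ b by positivity), abs_pow, abs_div, abs_abs,
    div_self (abs_ne_zero.2 hx), one_pow, one_mul]

lemma measurable_signPow (k : ℕ) (b : ℝ) : Measurable (signPow k b) := by
  unfold signPow
  exact ((measurable_id.div (by fun_prop)).pow_const k).mul (Measurable.pow_const (by fun_prop) _)

/-- Each differentiation contributes one more sign. The parity of `k` later decides whether the last
derivative, with exponent `0`, jumps at the origin. -/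
lemma hasDerivAt_signPow (k : ℕ) (b : ℝ) {x : ℝ} (hx : x ≠ 0) :
    HasDerivAt (signPow k b) (b * signPow (k + 1) (b - 1) x) x := by
  rcases lt_or_gt_of_ne hx with h | h
  · have h1 : HasDerivAt (fun y : ℝ => (-1) ^ k * (-y) ^ b)
        ((-1) ^ k * (-1 * b * (-x) ^ (b - 1))) x :=
      ((hasDerivAt_neg x).rpow_const (Or.inl (by linarith))).const_mul _
    refine (h1.congr_of_eventuallyEq ?_).congr_deriv ?_
    · filter_upwards [Iio_mem_nhds h] with y hy
      rw [signPow, abs_of_neg hy, div_neg, div_self (ne_of_lt hy)]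
    · rw [signPow, abs_of_neg h, div_neg, div_self hx]; ring
  · have h1 : HasDerivAt (fun y : ℝ => y ^ b) (b * x ^ (b - 1)) x :=
      Real.hasDerivAt_rpow_const (Or.inl hx)
    refine (h1.congr_of_eventuallyEq ?_).congr_deriv ?_
    · filter_upwards [Ioi_mem_nhds h] with y hy
      rw [signPow, abs_of_pos hy, div_self (ne_of_gt hy), one_pow, one_mul]
    · rw [signPow, abs_of_pos h, div_self hx, one_pow, one_mul]

lemma continuous_signPow (k : ℕ) {b : ℝ} (hb : 0 < b) : Continuous (signPow k b) := by
  rw [continuous_iff_continuousAt]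
  intro x
  rcases eq_or_ne x 0 with rfl | hx
  · have h0 : signPow k b 0 = 0 := by simp [signPow, Real.zero_rpow hb.ne']
    have h1 : Tendsto (fun x : ℝ => |x| ^ b) (𝓝 0) (𝓝 0) := by
      have : Continuous fun x : ℝ => |x| ^ b := by fun_prop (disch := positivity)
      simpa [Real.zero_rpow hb.ne'] using this.tendsto 0
    rw [ContinuousAt, h0]
    exact squeeze_zero_norm (fun x => abs_signPow_le k b x) h1
  · exact (hasDerivAt_signPow k b hx).continuousAt

lemma deriv_signPow (k : ℕ) {b : ℝ} (hb : 1 < b) :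
    Differentiable ℝ (signPow k b) ∧
      deriv (signPow k b) = fun x => b * signPow (k + 1) (b - 1) x := by
  have h : ∀ x, HasDerivAt (signPow k b) (b * signPow (k + 1) (b - 1) x) x :=
    hasDerivAt_of_off_countable (countable_singleton (0 : ℝ)) (continuous_signPow k (by linarith))
      (continuous_const.mul (continuous_signPow _ (by linarith)))
      fun x hx => hasDerivAt_signPow k b hx
  exact ⟨fun x => (h x).differentiableAt, funext fun x => (h x).deriv⟩

lemma contDiff_signPow (n k : ℕ) {b : ℝ} (hb : n < b) : ContDiff ℝ n (signPow k b) := by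
  induction n generalizing k b with
  | zero => exact contDiff_zero.2 (continuous_signPow k (by simpa using hb))
  | succ n ih =>
    push_cast at hb
    have hn : (0 : ℝ) ≤ n := n.cast_nonneg
    obtain ⟨h1, h2⟩ := deriv_signPow k (show 1 < b by linarith)
    push_cast
    rw [contDiff_succ_iff_deriv]
    refine ⟨h1, by simp, ?_⟩
    rw [h2]
    exact contDiff_const.mul (ih (k + 1) (by linarith))

lemma iteratedDeriv_signPow (n k : ℕ) {b : ℝ} (hb : n < b) :
    ∃ c : ℝ, c ≠ 0 ∧ iteratedDeriv n (signPow k b) = fun x => c * signPow (k + n) (b - n) x := by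
  induction n generalizing k b with
  | zero => exact ⟨1, one_ne_zero, by simp⟩
  | succ n ih =>
    push_cast at hb
    have hn : (0 : ℝ) ≤ n := n.cast_nonneg
    obtain ⟨c, hc, h⟩ := ih (k + 1) (b := b - 1) (by linarith)
    refine ⟨b * c, mul_ne_zero (by linarith) hc, ?_⟩
    rw [iteratedDeriv_succ', (deriv_signPow k (by linarith)).2]
    funext x
    have h1 : iteratedDeriv n (fun x => b * signPow (k + 1) (b - 1) x) x
        = b * iteratedDeriv n (signPow (k + 1) (b - 1)) x :=
      iteratedDeriv_const_mul b (contDiff_signPow n _ (by linarith)).contDiffAt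
    rw [h1, h]
    push_cast
    rw [show k + 1 + n = k + (n + 1) by ring, show b - 1 - n = b - (n + 1) by ring]
    ring

/-! ### Top order terms of iterated derivatives -/

section TopOrder

variable {E : Type*} [NormedAddCommGroup E] [NormedSpace ℝ E]

lemma ContDiff.iteratedDeriv_of_add {f : ℝ → E} {n : ℕ} {j : ℕ} (hf : ContDiff ℝ (n + j) f) :
    ContDiff ℝ n (iteratedDeriv j f) := by
  rw [iteratedDeriv_eq_iterate]
  exact ContDiff.iterate_deriv' n j hf

/-- In the Leibniz formula every other term has at most `j - 1` derivatives on `f` and at most `j`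
on `W`, hence is `C^1`. -/
lemma contDiff_iteratedDeriv_smul_sub (j : ℕ) {f : ℝ → ℝ} {W : ℝ → E} (hf : ContDiff ℝ j f)
    (hW : ContDiff ℝ (j + 1) W) :
    ContDiff ℝ 1 fun s => iteratedDeriv j (fun x => f x • W x) s - iteratedDeriv j f s • W s := by
  induction j generalizing f W with
  | zero => simpa using contDiff_const
  | succ j ih =>
    push_cast at hf hW
    have hf1 : ContDiff ℝ j (deriv f) := ContDiff.deriv_of_succ hf
    have hW1 : ContDiff ℝ (j + 1) (deriv W) := (contDiff_succ_iff_deriv.1 hW).2.2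
    have hW2 : ContDiff ℝ (j + 1) W := hW.of_le (by norm_cast; omega)
    have hd : deriv (fun x => f x • W x) = (fun x => deriv f x • W x) + fun x => f x • deriv W x := by
      funext x
      have h1 := (hf.differentiable (by norm_cast) x).hasDerivAt.fun_smul
        (hW2.differentiable (by norm_cast) x).hasDerivAt
      rw [h1.deriv, add_comm]; rfl
    have hc1 : ContDiff ℝ j (fun x => deriv f x • W x) :=
      hf1.smul (hW2.of_le (by norm_cast; omega))
    have hc2 : ContDiff ℝ (1 + j) (fun x => f x • deriv W x) := by
      rw [add_comm]; exact hf.smul hW1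
    have h2 : ContDiff ℝ 1 (iteratedDeriv j fun x => f x • deriv W x) :=
      ContDiff.iteratedDeriv_of_add (n := 1) (by exact_mod_cast hc2)
    convert (ih hf1 hW2).add h2 using 2 with s
    rw [iteratedDeriv_succ', hd, iteratedDeriv_add hc1.contDiffAt
      (hc2.of_le (by norm_cast; omega)).contDiffAt, iteratedDeriv_succ' (f := f)]
    abel

/-- In the iterated chain rule every other term involves only derivatives of `ψ` of order below `j`.
The induction writes `(ψ ∘ w)' = ψ'(w) w'` and applies the Leibniz version with `W = w'`. -/
lemma contDiff_iteratedDeriv_comp_sub (j : ℕ) {ψ w : ℝ → ℝ} (hψ : ContDiff ℝ j ψ)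
    (hw : ContDiff ℝ (j + 1) w) :
    ContDiff ℝ 1 fun s => iteratedDeriv j (fun x => ψ (w x)) s
      - iteratedDeriv j ψ (w s) * deriv w s ^ j := by
  induction j generalizing ψ with
  | zero => simpa using contDiff_const
  | succ j ih =>
    push_cast at hψ hw
    have hψ1 : ContDiff ℝ j (deriv ψ) := ContDiff.deriv_of_succ hψ
    have hw1 : ContDiff ℝ (j + 1) (deriv w) := (contDiff_succ_iff_deriv.1 hw).2.2
    have hw2 : ContDiff ℝ (j + 1) w := hw.of_le (by norm_cast; omega)
    have hd : deriv (fun x => ψ (w x)) = fun x => deriv ψ (w x) • deriv w x := by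
      funext x
      exact ((hψ.differentiable (by norm_cast) (w x)).hasDerivAt.comp x
        (hw2.differentiable (by norm_cast) x).hasDerivAt).deriv
    have h1 := contDiff_iteratedDeriv_smul_sub j
      (hψ1.comp (hw2.of_le (by norm_cast; omega) : ContDiff ℝ j w)) hw1
    have h2 := (ih hψ1 hw2).mul (hw1.of_le (by norm_cast; omega) : ContDiff ℝ 1 (deriv w))
    convert h1.add h2 using 2 with s
    rw [iteratedDeriv_succ', hd, iteratedDeriv_succ' (f := ψ)]
    simp only [Function.comp_def, smul_eq_mul]
    ring

/-- If `γ'' = ψ(w) W` with `ψ = |·|^{a-1}·` up to sign, then the highest continuous derivative of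
`γ` is a multiple of a power of `w` with exponent in `(0, 1]`, up to a `C^1` term. -/
lemma iteratedDeriv_eq_signPow_smul_add {γ W : ℝ → E} {w : ℝ → ℝ} {n : ℕ} {a : ℝ} (ha : n < a)
    (hγ : deriv (deriv γ) = fun s => signPow 1 a (w s) • W s) (hw : ContDiff ℝ (n + 1) w)
    (hW : ContDiff ℝ (n + 1) W) (hW0 : ∀ s, w s = 0 → W s ≠ 0) (hw0 : ∀ s, w s = 0 → deriv w s ≠ 0)
    (hw2 : ContDiff ℝ 2 w) :
    ∃ V R : ℝ → E, ContDiff ℝ 1 V ∧ ContDiff ℝ 1 R ∧ (∀ s, w s = 0 → V s ≠ 0) ∧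
      iteratedDeriv (n + 2) γ = fun s => signPow (1 + n) (a - n) (w s) • V s + R s := by
  obtain ⟨c, hc, hψ⟩ := iteratedDeriv_signPow n 1 ha
  have hψc := contDiff_signPow n 1 ha
  have h1 := contDiff_iteratedDeriv_smul_sub n
    (hψc.comp (hw.of_le (by norm_cast; omega) : ContDiff ℝ n w)) hW
  have h2 := contDiff_iteratedDeriv_comp_sub n hψc hw
  have hW1 : ContDiff ℝ 1 W := hW.of_le (by norm_cast; omega)
  have hw' : ContDiff ℝ 1 (deriv w) := (contDiff_succ_iff_deriv.1 (by exact_mod_cast hw2)).2.2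
  -- `V` collects the constant from differentiating the signed power `n` times and the chain rule
  -- factor `w'^n`; neither vanishes at a zero of `w`.
  refine ⟨fun s => (c * deriv w s ^ n) • W s, _, (contDiff_const.mul (hw'.pow n)).smul hW1,
    h1.add (h2.smul hW1), fun s hs => smul_ne_zero (mul_ne_zero hc (pow_ne_zero _ (hw0 s hs)))
      (hW0 s hs), ?_⟩
  funext s
  rw [iteratedDeriv_succ', iteratedDeriv_succ', hγ, hψ]
  simp only [Function.comp_def, Pi.smul_apply']
  module

end TopOrder

/-! ### Sobolev regularity of `sgn(w)^k |w|^b V + R` -/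

section PowerSobolev

variable {E : Type*} [NormedAddCommGroup E] [NormedSpace ℝ E]
  {A B b : ℝ} {k : ℕ} {w : ℝ → ℝ} {V R : ℝ → E}

/-- The derivative of `sgn(w)^k |w|^b V + R` off the zeros of `w`. -/
def powDeriv (k : ℕ) (b : ℝ) (w : ℝ → ℝ) (V R : ℝ → E) (s : ℝ) : E :=
  (b * signPow (k + 1) (b - 1) (w s) * deriv w s) • V s +
    (signPow k b (w s) • deriv V s + deriv R s)

lemma continuous_powDeriv_lower (hb : 0 < b) (hw : ContDiff ℝ 1 w) (hV : ContDiff ℝ 1 V)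
    (hR : ContDiff ℝ 1 R) : Continuous fun s => signPow k b (w s) • deriv V s + deriv R s :=
  (((continuous_signPow k hb).comp hw.continuous).smul (hV.continuous_deriv le_rfl)).add
    (hR.continuous_deriv le_rfl)

lemma stronglyMeasurable_powDeriv_top (hw : ContDiff ℝ 1 w) (hV : ContDiff ℝ 1 V) :
    StronglyMeasurable fun s => (b * signPow (k + 1) (b - 1) (w s) * deriv w s) • V s := by
  refine StronglyMeasurable.smul (Measurable.stronglyMeasurable ?_) hV.continuous.stronglyMeasurable
  exact (((measurable_signPow _ _).comp hw.continuous.measurable).const_mul b).mul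
    (hw.continuous_deriv le_rfl).measurable

lemma stronglyMeasurable_powDeriv (hb : 0 < b) (hw : ContDiff ℝ 1 w) (hV : ContDiff ℝ 1 V)
    (hR : ContDiff ℝ 1 R) : StronglyMeasurable (powDeriv k b w V R) :=
  (stronglyMeasurable_powDeriv_top hw hV).add
    (continuous_powDeriv_lower hb hw hV hR).stronglyMeasurable

lemma exists_norm_powDeriv_top_le (hw : ContDiff ℝ 1 w) (hV : ContDiff ℝ 1 V) :
    ∃ C : ℝ, ∀ s ∈ Icc A B, ‖(b * signPow (k + 1) (b - 1) (w s) * deriv w s) • V s‖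
      ≤ C * ‖|w s| ^ (b - 1)‖ := by
  have hc : Continuous fun s => (b * deriv w s) • V s :=
    (continuous_const.mul (hw.continuous_deriv le_rfl)).smul hV.continuous
  obtain ⟨C, hC⟩ := isCompact_Icc.exists_bound_of_continuousOn (s := Icc A B) hc.continuousOn
  refine ⟨C, fun s hs => ?_⟩
  rw [Real.norm_of_nonneg (show 0 ≤ |w s| ^ (b - 1) by positivity)]
  have h2 : (b * signPow (k + 1) (b - 1) (w s) * deriv w s) • V s =
      signPow (k + 1) (b - 1) (w s) • (b * deriv w s) • V s := by rw [smul_smul]; ring_nf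
  rw [h2, norm_smul, mul_comm]
  exact mul_le_mul (hC s hs) (abs_signPow_le _ _ _) (norm_nonneg _)
    ((norm_nonneg _).trans (hC s hs))

lemma memLp_powDeriv_of_memLp {r : ℝ≥0∞} (hb : 0 < b) (hw : ContDiff ℝ 1 w) (hV : ContDiff ℝ 1 V)
    (hR : ContDiff ℝ 1 R)
    (h : MemLp (fun s => |w s| ^ (b - 1)) r (volume.restrict (Ioo A B))) :
    MemLp (powDeriv k b w V R) r (volume.restrict (Ioo A B)) := by
  obtain ⟨C, hC⟩ := exists_norm_powDeriv_top_le (A := A) (B := B) (b := b) (k := k) hw hV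
  refine MemLp.add (h.of_le_mul (c := C)
    (stronglyMeasurable_powDeriv_top hw hV).aestronglyMeasurable ?_)
    (memLp_Ioo_of_continuous (continuous_powDeriv_lower hb hw hV hR))
  rw [ae_restrict_iff' measurableSet_Ioo]
  exact Eventually.of_forall fun s hs => hC s (Ioo_subset_Icc_self hs)

/-- The zeros of `w` are simple, so near each zero `s` the `r`-th power is comparable to `|x -
s|^(-r(1-b))`, which is integrable for `r(1-b) < 1`. -/
lemma memLp_abs_rpow {r : ℝ} (hr : 0 < r) (hrb : r * (1 - b) < 1) (hb : b ≤ 1)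
    (hw : ContDiff ℝ 1 w) (hw0 : ∀ s, w s = 0 → deriv w s ≠ 0) :
    MemLp (fun s => |w s| ^ (b - 1)) (ENNReal.ofReal r) (volume.restrict (Ioo A B)) := by
  have hm : Measurable fun s => |w s| ^ (b - 1) :=
    Measurable.pow_const hw.continuous.abs.measurable _
  rw [← integrable_norm_rpow_iff hm.aestronglyMeasurable (by simpa using hr) (by simp),
    ENNReal.toReal_ofReal hr.le]
  have h1 := locallyIntegrable_abs_rpow_of_simple_zeros hw.continuous
    (fun s hs => ⟨_, hw0 s hs, (hw.differentiable (by simp) s).hasDerivAt⟩)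
    (β := r * (1 - b)) (mul_nonneg hr.le (by linarith)) hrb
  have h2 := (h1.integrableOn_isCompact (isCompact_Icc (a := A) (b := B))).mono_set
    Ioo_subset_Icc_self
  refine h2.congr (Eventually.of_forall fun s => ?_)
  simp only
  rw [Real.norm_of_nonneg (by positivity), ← Real.rpow_mul (abs_nonneg _)]
  ring_nf

lemma hasWeakDeriv_powDeriv [CompleteSpace E] (hb : 0 < b) (hb1 : b ≤ 1) (hw : ContDiff ℝ 1 w)
    (hV : ContDiff ℝ 1 V) (hR : ContDiff ℝ 1 R) (hw0 : ∀ s, w s = 0 → deriv w s ≠ 0)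
    (hc : {s | w s = 0}.Countable) :
    HasWeakDeriv A B (fun s => signPow k b (w s) • V s + R s) (powDeriv k b w V R) := by
  refine hasWeakDeriv_of_hasDerivAt_off_countable hc
    ((((continuous_signPow k hb).comp hw.continuous).smul hV.continuous).add hR.continuous) ?_ ?_
  · intro s hs
    have h1 := (hasDerivAt_signPow k b (x := w s) hs).comp s
      (hw.differentiable (by simp) s).hasDerivAt
    have h2 := (h1.fun_smul (hV.differentiable (by simp) s).hasDerivAt).add
      (hR.differentiable (by simp) s).hasDerivAt
    refine h2.congr_deriv ?_
    simp only [powDeriv, Function.comp_apply]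
    abel
  · rw [locallyIntegrable_iff]
    intro K hK
    obtain ⟨r, hr⟩ := hK.isBounded.subset_closedBall 0
    have h1 := memLp_powDeriv_of_memLp (k := k) hb hw hV hR
      (memLp_abs_rpow (A := -r - 1) (B := r + 1) one_pos (by linarith) hb1 hw hw0)
    rw [ENNReal.ofReal_one, memLp_one_iff_integrable] at h1
    refine IntegrableOn.mono_set h1 fun x hx => ?_
    have := hr hx
    rw [Metric.mem_closedBall, Real.dist_eq, sub_zero, abs_le] at this
    constructor <;> linarith

/-- At the critical exponent `ρ = 1/(1-b)` one has `(b-1)ρ = -1`, so the `ρ`-th power of the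
top-order term is at least a multiple of `1/|x-s|`. This diverges even one-sidedly, so `s` may be an
endpoint. -/
lemma not_memLp_powDeriv (hb : 0 < b) (hb1 : b < 1) (hAB : A < B) (hw : ContDiff ℝ 1 w)
    (hV : ContDiff ℝ 1 V) (hR : ContDiff ℝ 1 R) {s : ℝ} (hs : s ∈ Icc A B) (hws : w s = 0)
    (hw's : deriv w s ≠ 0) (hVs : V s ≠ 0) :
    ¬ MemLp (powDeriv k b w V R) (ENNReal.ofReal (1 - b)⁻¹) (volume.restrict (Ioo A B)) := by
  intro h
  set ρ := (1 - b)⁻¹ with hρ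
  have hρ0 : 0 < ρ := inv_pos.2 (by linarith)
  set T : ℝ → E := fun s => (b * signPow (k + 1) (b - 1) (w s) * deriv w s) • V s with hT
  have h1 : MemLp T (ENNReal.ofReal ρ) (volume.restrict (Ioo A B)) := by
    have h2 := h.sub (memLp_Ioo_of_continuous (continuous_powDeriv_lower (k := k) hb hw hV hR))
    refine h2.ae_eq (Eventually.of_forall fun x => ?_)
    simp [powDeriv, hT]
  rw [← integrable_norm_rpow_iff h1.1 (by simpa using hρ0) (by simp),
    ENNReal.toReal_ofReal hρ0.le] at h1
  have h2 : IntervalIntegrable (fun x => ‖T x‖ ^ ρ) volume A B := by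
    rw [intervalIntegrable_iff_integrableOn_Ioo_of_le hAB.le]
    exact h1
  refine not_intervalIntegrable_of_sub_inv_isBigO_punctured (c := s) ?_ hAB.ne ?_ h2
  · have hd := (hw.differentiable (by simp) s).hasDerivAt
    obtain ⟨c, hc, hc1⟩ := exists_abs_le_mul_of_hasDerivAt hws hd
    obtain ⟨c', hc', hc1'⟩ := exists_mul_abs_le_of_hasDerivAt hws hd hw's
    set D : ℝ := ‖(b * deriv w s) • V s‖ / 2 with hD
    have hD0 : 0 < D := by
      have : (b * deriv w s) • V s ≠ 0 := smul_ne_zero (mul_ne_zero hb.ne' hw's) hVs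
      have := norm_pos_iff.2 this
      positivity
    have hDc : ContinuousAt (fun x => ‖(b * deriv w x) • V x‖) s :=
      ((continuous_const.mul (hw.continuous_deriv le_rfl)).smul hV.continuous).norm.continuousAt
    have hDe : ∀ᶠ x in 𝓝 s, D < ‖(b * deriv w x) • V x‖ :=
      hDc.eventually (lt_mem_nhds (show D < ‖(b * deriv w s) • V s‖ by linarith))
    set M : ℝ := (c ^ (b - 1) * D) ^ ρ with hM
    have hM0 : 0 < M := by positivity
    refine Asymptotics.IsBigO.of_bound M⁻¹ ?_
    filter_upwards [nhdsWithin_le_nhds hc1, nhdsWithin_le_nhds hc1', nhdsWithin_le_nhds hDe,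
      self_mem_nhdsWithin] with x h1 h1' h2 h3
    have hpos : 0 < |x - s| := abs_pos.2 (sub_ne_zero.2 h3)
    have hwx : w x ≠ 0 := abs_pos.1 (lt_of_lt_of_le (by positivity) h1')
    have hTx : c ^ (b - 1) * D * |x - s| ^ (b - 1) ≤ ‖T x‖ := by
      have e : T x = signPow (k + 1) (b - 1) (w x) • (b * deriv w x) • V x := by
        simp only [hT]; rw [smul_smul]; ring_nf
      rw [e, norm_smul, Real.norm_eq_abs, abs_signPow _ _ hwx]
      have h4 : (c * |x - s|) ^ (b - 1) ≤ |w x| ^ (b - 1) :=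
        Real.rpow_le_rpow_of_nonpos (abs_pos.2 hwx) h1 (by linarith)
      rw [Real.mul_rpow hc.le hpos.le] at h4
      calc c ^ (b - 1) * D * |x - s| ^ (b - 1) = (c ^ (b - 1) * |x - s| ^ (b - 1)) * D := by ring
        _ ≤ _ := by gcongr
    have h5 := Real.rpow_le_rpow (by positivity) hTx hρ0.le
    rw [Real.mul_rpow (by positivity) (by positivity), ← hM, ← Real.rpow_mul hpos.le,
      show (b - 1) * ρ = -1 by rw [hρ]; have : 1 - b ≠ 0 := by linarith
                               field_simp; ring, Real.rpow_neg_one] at h5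
    rw [Real.norm_of_nonneg (by positivity : 0 ≤ ‖T x‖ ^ ρ), norm_inv, Real.norm_eq_abs,
      le_inv_mul_iff₀ hM0]
    exact h5
  · rw [uIcc_of_le hAB.le]; exact hs

lemma exists_sign_eventually_eq {w' s : ℝ} (hws : w s = 0) (hd : HasDerivAt w w' s) (hw' : w' ≠ 0) :
    ∃ ε : ℝ, ε ≠ 0 ∧ (∀ᶠ x in 𝓝[>] s, w x / |w x| = ε) ∧ ∀ᶠ x in 𝓝[<] s, w x / |w x| = -ε := by
  have hsl := hasDerivAt_iff_tendsto_slope.1 hd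
  have hr : 𝓝[>] s ≤ 𝓝[≠] s := nhdsWithin_mono _ fun x hx => ne_of_gt hx
  have hl : 𝓝[<] s ≤ 𝓝[≠] s := nhdsWithin_mono _ fun x hx => ne_of_lt hx
  have hslope : ∀ x, x ≠ s → w x = slope w s x * (x - s) := fun x hx => by
    rw [slope_def_field, hws, sub_zero, div_mul_cancel₀ _ (sub_ne_zero.2 hx)]
  rcases lt_or_gt_of_ne hw' with h | h
  · have h1 := hsl.eventually (gt_mem_nhds h)
    refine ⟨-1, by norm_num, ?_, ?_⟩
    · filter_upwards [hr h1, self_mem_nhdsWithin] with x h1 h2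
      have : w x < 0 := by
        rw [hslope x (ne_of_gt h2)]; exact mul_neg_of_neg_of_pos h1 (sub_pos.2 h2)
      rw [abs_of_neg this, div_neg, div_self this.ne]
    · filter_upwards [hl h1, self_mem_nhdsWithin] with x h1 h2
      have : 0 < w x := by
        rw [hslope x (ne_of_lt h2)]; exact mul_pos_of_neg_of_neg h1 (sub_neg.2 h2)
      rw [abs_of_pos this, div_self this.ne', neg_neg]
  · have h1 := hsl.eventually (lt_mem_nhds h)
    refine ⟨1, by norm_num, ?_, ?_⟩
    · filter_upwards [hr h1, self_mem_nhdsWithin] with x h1 h2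
      have : 0 < w x := by
        rw [hslope x (ne_of_gt h2)]; exact mul_pos h1 (sub_pos.2 h2)
      rw [abs_of_pos this, div_self this.ne']
    · filter_upwards [hl h1, self_mem_nhdsWithin] with x h1 h2
      have : w x < 0 := by
        rw [hslope x (ne_of_lt h2)]; exact mul_neg_of_pos_of_neg h1 (sub_neg.2 h2)
      rw [abs_of_neg this, div_neg, div_self this.ne]

/-- With `k + 1` odd, the one-sided limits of the top-order term at `s` are opposite and non-zero,
while the remaining terms are continuous: a jump that no weakly differentiable function has. -/
lemma not_hasWeakDeriv_powDeriv_one [CompleteSpace E] (hk : Even k) (hw : ContDiff ℝ 1 w)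
    (hV : ContDiff ℝ 1 V) (hR : ContDiff ℝ 1 R) {s : ℝ} (hs : s ∈ Ioo A B) (hws : w s = 0)
    (hw's : deriv w s ≠ 0) (hVs : V s ≠ 0) (g : ℝ → E) :
    ¬ HasWeakDeriv A B (powDeriv k 1 w V R) g := by
  intro h
  obtain ⟨ε, hε, hr, hl⟩ := exists_sign_eventually_eq hws
    (hw.differentiable (by simp) s).hasDerivAt hw's
  have hlow := (continuous_powDeriv_lower (k := k) one_pos hw hV hR).tendsto s
  have htop : Continuous fun x => deriv w x • V x :=
    (hw.continuous_deriv le_rfl).smul hV.continuous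
  have key : ∀ (l : Filter ℝ) (δ : ℝ), l ≤ 𝓝 s → (∀ᶠ x in l, w x / |w x| = δ) →
      Tendsto (powDeriv k 1 w V R) l (𝓝 (δ ^ (k + 1) • deriv w s • V s +
        (signPow k 1 (w s) • deriv V s + deriv R s))) := fun l δ hl hδ => by
    refine (((htop.tendsto s).const_smul (δ ^ (k + 1))).add hlow).mono_left hl |>.congr' ?_
    filter_upwards [hδ] with x hx
    simp only [powDeriv]
    congr 1
    rw [signPow, hx, sub_self, Real.rpow_zero, one_mul, mul_one, smul_smul]
  have heq := h.eq_of_tendsto (stronglyMeasurable_powDeriv one_pos hw hV hR) hs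
    (key _ _ nhdsWithin_le_nhds hl) (key _ _ nhdsWithin_le_nhds hr)
  rw [add_left_inj, hk.add_one.neg_pow, neg_smul, neg_eq_iff_add_eq_zero, ← two_smul ℝ] at heq
  exact smul_ne_zero two_ne_zero
    (smul_ne_zero (pow_ne_zero _ hε) (smul_ne_zero hw's hVs)) heq

end PowerSobolev

/-! ### Plane curves in coordinates and reparameterization -/

lemma hasDerivAt_plane {X Y : ℝ → ℝ} {x y s : ℝ} (hX : HasDerivAt X x s) (hY : HasDerivAt Y y s) :
    HasDerivAt (fun s => (!₂[X s, Y s] : Plane)) !₂[x, y] s := by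
  have h : HasDerivAt (fun s => ![X s, Y s]) ![x, y] s := by
    rw [hasDerivAt_pi]
    intro i
    fin_cases i <;> simpa
  exact (PiLp.continuousLinearEquiv 2 ℝ fun _ : Fin 2 => ℝ).symm.hasFDerivAt.comp_hasDerivAt s h

lemma analyticAt_plane {X Y : ℝ → ℝ} {s : ℝ} (hX : AnalyticAt ℝ X s) (hY : AnalyticAt ℝ Y s) :
    AnalyticAt ℝ (fun s => (!₂[X s, Y s] : Plane)) s := by
  have h : AnalyticAt ℝ (fun s => ![X s, Y s]) s := by
    rw [analyticAt_pi_iff]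
    intro i
    fin_cases i <;> simpa
  exact ((PiLp.continuousLinearEquiv 2 ℝ fun _ : Fin 2 => ℝ).symm.analyticAt _).comp h

lemma norm_plane_eq_one {x y : ℝ} (h : x ^ 2 + y ^ 2 = 1) : ‖(!₂[x, y] : Plane)‖ = 1 := by
  simp [EuclideanSpace.norm_eq, Fin.sum_univ_two, h]

/-- Lagrange's identity. The square makes it insensitive to orientation, as needed for images under
isometries that may be reflections. -/
lemma det_sq_eq_one_of_orthonormal {x y : Plane} (hx : ‖x‖ = 1) (hy : ‖y‖ = 1)
    (hxy : inner ℝ x y = 0) : (x 0 * y 1 - x 1 * y 0) ^ 2 = 1 := by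
  have h1 : x 0 ^ 2 + x 1 ^ 2 = 1 := by
    have := EuclideanSpace.real_norm_sq_eq x
    rw [hx, Fin.sum_univ_two] at this
    linarith
  have h2 : y 0 ^ 2 + y 1 ^ 2 = 1 := by
    have := EuclideanSpace.real_norm_sq_eq y
    rw [hy, Fin.sum_univ_two] at this
    linarith
  have h3 : x 0 * y 0 + x 1 * y 1 = 0 := by
    simp [PiLp.inner_apply, Fin.sum_univ_two] at hxy
    linarith
  calc (x 0 * y 1 - x 1 * y 0) ^ 2
      = (x 0 ^ 2 + x 1 ^ 2) * (y 0 ^ 2 + y 1 ^ 2) - (x 0 * y 0 + x 1 * y 1) ^ 2 := by ring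
    _ = 1 := by rw [h1, h2, h3]; norm_num

/-- If both a curve and the curve that represents it have unit speed up to a dilation, then the
change of parameter is affine. -/
lemma IsRepresentedBy.exists_affine {L : ℝ} (hL : 0 < L) {γ Γ T : ℝ → Plane}
    (harc : IsArclength L γ) (h : IsRepresentedBy L γ Γ) (hΓ : ∀ s, HasDerivAt Γ (T s) s)
    (hT : ∀ s, ‖T s‖ = 1) :
    ∃ (c : ℝ) (U : Plane ≃ₗᵢ[ℝ] Plane) (v : Plane) (σ t : ℝ), 0 < c ∧ σ ≠ 0 ∧
      ∀ s ∈ Icc 0 L, γ s = c • U (Γ (σ * s + t)) + v := by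
  obtain ⟨c, U, v, φ, hc, hφ, -, hγ⟩ := h
  have hu : UniqueDiffOn ℝ (Icc 0 L) := uniqueDiffOn_Icc hL
  have hd : ∀ s ∈ Icc 0 L, HasDerivWithinAt φ (derivWithin φ (Icc 0 L) s) (Icc 0 L) s :=
    fun s hs => (hφ.differentiableOn (by simp) s hs).hasDerivWithinAt
  have hnorm : ∀ s ∈ Icc 0 L, c * |derivWithin φ (Icc 0 L) s| = 1 := fun s hs => by
    have h1 : HasDerivWithinAt (fun x => c • U (Γ (φ x)) + v)
        (c • U (derivWithin φ (Icc 0 L) s • T (φ s))) (Icc 0 L) s := by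
      have h2 : HasDerivWithinAt (fun x => Γ (φ x)) (derivWithin φ (Icc 0 L) s • T (φ s))
          (Icc 0 L) s := (hΓ (φ s)).scomp_hasDerivWithinAt s (hd s hs)
      have h3 := (U.toContinuousLinearEquiv.hasFDerivAt (x := Γ (φ s))).comp_hasDerivWithinAt s h2
      exact (h3.const_smul c).add_const v
    have h4 := (h1.congr hγ (hγ s hs)).derivWithin (hu s hs)
    have h5 := harc s hs
    rw [velocity, h4, norm_smul, U.norm_map, norm_smul, hT, mul_one, Real.norm_eq_abs,
      Real.norm_eq_abs, abs_of_pos hc] at h5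
    exact h5
  have hcont : ContinuousOn (derivWithin φ (Icc 0 L)) (Icc 0 L) :=
    hφ.continuousOn_derivWithin hu le_rfl
  -- Comparing speeds gives `|φ'| = c⁻¹`; since `φ'` is continuous on an interval, its sign is
  -- constant.
  obtain ⟨σ, hσ, hσφ⟩ : ∃ σ : ℝ, σ ≠ 0 ∧ ∀ s ∈ Icc 0 L, derivWithin φ (Icc 0 L) s = σ := by
    have hsq : EqOn (derivWithin φ (Icc 0 L) ^ 2) ((fun _ => c⁻¹) ^ 2) (Icc 0 L) := fun s hs => by
      simp only [Pi.pow_apply]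
      rw [← sq_abs, eq_inv_of_mul_eq_one_right (hnorm s hs)]
    rcases isPreconnected_Icc.eq_or_eq_neg_of_sq_eq hcont continuousOn_const hsq
      (fun _ => inv_ne_zero hc.ne') with h | h
    · exact ⟨c⁻¹, inv_ne_zero hc.ne', h⟩
    · exact ⟨-c⁻¹, neg_ne_zero.2 (inv_ne_zero hc.ne'), h⟩
  refine ⟨c, U, v, σ, φ 0, hc, hσ, fun s hs => ?_⟩
  have h1 : ∀ s ∈ Icc 0 L, φ s - σ * s = φ 0 - σ * 0 := by
    refine constant_of_derivWithin_zero (f := fun s => φ s - σ * s)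
      ((hφ.differentiableOn (by simp)).sub (by fun_prop)) fun s hs => ?_
    have hs' := Ico_subset_Icc_self hs
    have h2 : HasDerivWithinAt (fun s => φ s - σ * s) (derivWithin φ (Icc 0 L) s - σ)
        (Icc 0 L) s := by
      simpa using (hd s hs').fun_sub (((hasDerivAt_id s).const_mul σ).hasDerivWithinAt)
    rw [h2.derivWithin (hu s hs'), hσφ s hs', sub_self]
  rw [hγ s hs]
  congr 4
  linarith [h1 s hs]

/-- After the affine reparameterization, only analyticity of the unit tangent is needed: the
coordinates are its primitives. -/
lemma analyticOn_of_isRepresentedBy {L : ℝ} (hL : 0 < L) {γ : ℝ → Plane} {X Y C S : ℝ → ℝ}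
    (harc : IsArclength L γ) (h : IsRepresentedBy L γ fun s => !₂[X s, Y s])
    (hX : ∀ s, HasDerivAt X (C s) s) (hY : ∀ s, HasDerivAt Y (S s) s)
    (hCS : ∀ s, C s ^ 2 + S s ^ 2 = 1) (hC : ∀ s, AnalyticAt ℝ C s) (hS : ∀ s, AnalyticAt ℝ S s) :
    AnalyticOn ℝ γ (Icc 0 L) := by
  obtain ⟨c, U, v, σ, t, -, -, hγ⟩ := h.exists_affine hL harc
    (fun s => hasDerivAt_plane (hX s) (hY s)) (fun s => norm_plane_eq_one (hCS s))
  have hA : ∀ s, AnalyticAt ℝ (fun s => (!₂[X s, Y s] : Plane)) s := fun s =>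
    analyticAt_plane (analyticAt_of_eventually_hasDerivAt (Eventually.of_forall hX) (hC s))
      (analyticAt_of_eventually_hasDerivAt (Eventually.of_forall hY) (hS s))
  have hB : ∀ s, AnalyticAt ℝ (fun s => c • U (!₂[X (σ * s + t), Y (σ * s + t)]) + v) s := by
    intro s
    have h1 : AnalyticAt ℝ (fun s => U (!₂[X (σ * s + t), Y (σ * s + t)])) s :=
      (U.toContinuousLinearEquiv.analyticAt _).comp
        ((hA (σ * s + t)).comp (f := fun s => σ * s + t) (by fun_prop))
    exact (analyticAt_const.fun_smul h1).fun_add analyticAt_const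
  exact AnalyticOn.congr (fun s _ => (hB s).analyticWithinAt) hγ

/-! ### Inverses of expanding functions -/

section Inverse

variable {F : ℝ → ℝ} {D : Set ℝ}

lemma invFunOn_spec (hs : SurjOn F D univ) (s : ℝ) :
    Function.invFunOn F D s ∈ D ∧ F (Function.invFunOn F D s) = s :=
  ⟨Function.invFunOn_mem (hs (mem_univ s)), Function.invFunOn_eq (hs (mem_univ s))⟩

/-- The inverse of an expanding function is 1-Lipschitz. This gives continuity of the amplitude even
where `F` has no finite derivative. -/
lemma continuous_invFunOn (hs : SurjOn F D univ)
    (he : ∀ x ∈ D, ∀ y ∈ D, x ≤ y → y - x ≤ F y - F x) : Continuous (Function.invFunOn F D) := by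
  refine LipschitzWith.continuous (K := 1) (LipschitzWith.of_dist_le_mul fun s t => ?_)
  obtain ⟨h1, h2⟩ := invFunOn_spec hs s
  obtain ⟨h3, h4⟩ := invFunOn_spec hs t
  rw [NNReal.coe_one, one_mul, Real.dist_eq, Real.dist_eq]
  rcases le_total (Function.invFunOn F D s) (Function.invFunOn F D t) with h | h
  · have := he _ h1 _ h3 h
    rw [h2, h4] at this
    rw [abs_sub_comm, abs_sub_comm s, abs_of_nonneg (sub_nonneg.2 h)]
    exact this.trans (le_abs_self _)
  · have := he _ h3 _ h1 h
    rw [h2, h4] at this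
    rw [abs_of_nonneg (sub_nonneg.2 h)]
    exact this.trans (le_abs_self _)

lemma injective_invFunOn (hs : SurjOn F D univ) : Function.Injective (Function.invFunOn F D) :=
  fun s t h => by rw [← (invFunOn_spec hs s).2, h, (invFunOn_spec hs t).2]

lemma hasDerivAt_invFunOn (hs : SurjOn F D univ)
    (he : ∀ x ∈ D, ∀ y ∈ D, x ≤ y → y - x ≤ F y - F x) {d s : ℝ}
    (hd : HasDerivAt F d (Function.invFunOn F D s)) (h0 : d ≠ 0) :
    HasDerivAt (Function.invFunOn F D) d⁻¹ s :=
  hd.of_local_left_inverse (continuous_invFunOn hs he).continuousAt h0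
    (Eventually.of_forall fun t => (invFunOn_spec hs t).2)

lemma surjOn_univ_of_expanding (hc : Continuous F) (he : ∀ x y, x ≤ y → y - x ≤ F y - F x) :
    SurjOn F univ univ := by
  refine (Continuous.surjective hc ?_ ?_).surjOn
  · refine tendsto_atTop_mono' atTop ?_ (tendsto_atTop_add_const_right atTop (F 0) tendsto_id)
    filter_upwards [eventually_ge_atTop 0] with x hx
    have := he 0 x hx
    simp only [id]
    linarith
  · refine tendsto_atBot_mono' atBot ?_ (tendsto_atBot_add_const_right atBot (F 0) tendsto_id)
    filter_upwards [eventually_le_atBot 0] with x hx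
    have := he x 0 hx
    simp only [id]
    linarith

lemma expanding_integral {f : ℝ → ℝ} (hi : ∀ x y, IntervalIntegrable f volume x y)
    (h1 : ∀ᵐ x, 1 ≤ f x) {x y : ℝ} (hxy : x ≤ y) :
    y - x ≤ (∫ t in (0 : ℝ)..y, f t) - ∫ t in (0 : ℝ)..x, f t := by
  rw [intervalIntegral.integral_interval_sub_left (hi _ _) (hi _ _)]
  calc y - x = ∫ _ in x..y, (1 : ℝ) := by simp
    _ ≤ _ := intervalIntegral.integral_mono_ae hxy intervalIntegrable_const (hi _ _) h1

end Inverse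

/-! ### The amplitude functions -/

lemma countable_cos_eq_zero : {x : ℝ | Real.cos x = 0}.Countable := by
  refine (countable_range fun k : ℤ => (2 * (k : ℝ) + 1) * Real.pi / 2).mono fun x hx => ?_
  obtain ⟨k, hk⟩ := Real.cos_eq_zero_iff.1 hx
  exact ⟨k, hk.symm⟩

/-- The zeros of the cosine are simple and the exponent exceeds `-1` because `p > 1`. -/
lemma intervalIntegrable_abs_cos_rpow {p : ℝ} (hp1 : 1 < p) (hp2 : p ≤ 2) (x y : ℝ) :
    IntervalIntegrable (fun θ => |Real.cos θ| ^ (1 - 2 / p)) volume x y := by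
  have h1 : 2 / p < 2 := by rw [div_lt_iff₀] <;> linarith
  have h2 : 1 ≤ 2 / p := by rw [le_div_iff₀] <;> linarith
  have h := locallyIntegrable_abs_rpow_of_simple_zeros Real.continuous_cos
    (fun s hs => ⟨-Real.sin s, fun h => by
      have := Real.sin_sq_add_cos_sq s
      rw [hs, neg_eq_zero.1 h] at this
      norm_num at this, Real.hasDerivAt_cos s⟩) (β := 2 / p - 1) (by linarith) (by linarith)
  simp only [neg_sub] at h
  exact (h.integrableOn_isCompact isCompact_uIcc).intervalIntegrable

variable {p q : ℝ}

lemma one_sub_sq_mul_sin_sq_pos (hq0 : 0 < q) (hq1 : q < 1) (x : ℝ) :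
    0 < 1 - q ^ 2 * Real.sin x ^ 2 := by
  have h1 : Real.sin x ^ 2 ≤ 1 := Real.sin_sq_le_one x
  have h2 : q ^ 2 < 1 := by nlinarith
  nlinarith [sq_nonneg q, sq_nonneg (Real.sin x)]

lemma one_sub_sq_mul_sin_sq_le_one (x : ℝ) : 1 - q ^ 2 * Real.sin x ^ 2 ≤ 1 := by
  nlinarith [mul_nonneg (sq_nonneg q) (sq_nonneg (Real.sin x))]

lemma continuous_sqrt_delta : Continuous fun x => √(1 - q ^ 2 * Real.sin x ^ 2) := by fun_prop

lemma sqrt_delta_pos (hq0 : 0 < q) (hq1 : q < 1) (x : ℝ) : 0 < √(1 - q ^ 2 * Real.sin x ^ 2) :=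
  Real.sqrt_pos.2 (one_sub_sq_mul_sin_sq_pos hq0 hq1 x)

lemma continuousAt_abs_cos_rpow (b : ℝ) {x : ℝ} (hx : Real.cos x ≠ 0) :
    ContinuousAt (fun θ => |Real.cos θ| ^ b) x :=
  ContinuousAt.rpow_const (by fun_prop) (Or.inl (abs_ne_zero.2 hx))

lemma measurable_abs_cos_rpow (b : ℝ) : Measurable fun θ => |Real.cos θ| ^ b :=
  Measurable.pow_const (by fun_prop) _

section Wavelike

variable (hp1 : 1 < p) (hp2 : p ≤ 2) (hq0 : 0 < q) (hq1 : q < 1)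
include hp1 hp2 hq0 hq1

lemma intervalIntegrable_F1 (x y : ℝ) :
    IntervalIntegrable (fun θ => |Real.cos θ| ^ (1 - 2 / p) / √(1 - q ^ 2 * Real.sin θ ^ 2))
      volume x y := by
  simp only [div_eq_mul_inv _ (√_)]
  exact (intervalIntegrable_abs_cos_rpow hp1 hp2 x y).mul_continuousOn
    (continuous_sqrt_delta.inv₀ fun x => (sqrt_delta_pos hq0 hq1 x).ne').continuousOn

omit hq0 hq1 in
lemma intervalIntegrable_E1 (x y : ℝ) :
    IntervalIntegrable (fun θ => √(1 - q ^ 2 * Real.sin θ ^ 2) * |Real.cos θ| ^ (1 - 2 / p))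
      volume x y :=
  (intervalIntegrable_abs_cos_rpow hp1 hp2 x y).continuousOn_mul continuous_sqrt_delta.continuousOn

lemma hasDerivAt_F1 {x : ℝ} (hx : Real.cos x ≠ 0) :
    HasDerivAt (F1 p q) (|Real.cos x| ^ (1 - 2 / p) / √(1 - q ^ 2 * Real.sin x ^ 2)) x := by
  refine intervalIntegral.integral_hasDerivAt_right (intervalIntegrable_F1 hp1 hp2 hq0 hq1 _ _) ?_ ?_
  · exact ((measurable_abs_cos_rpow _).div
      (by fun_prop)).stronglyMeasurable.stronglyMeasurableAtFilter
  · exact (continuousAt_abs_cos_rpow _ hx).div continuous_sqrt_delta.continuousAt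
      (sqrt_delta_pos hq0 hq1 x).ne'

omit hq0 hq1 in
lemma hasDerivAt_E1 {x : ℝ} (hx : Real.cos x ≠ 0) :
    HasDerivAt (E1 p q) (√(1 - q ^ 2 * Real.sin x ^ 2) * |Real.cos x| ^ (1 - 2 / p)) x := by
  refine intervalIntegral.integral_hasDerivAt_right (intervalIntegrable_E1 hp1 hp2 _ _) ?_ ?_
  · exact (Measurable.mul (by fun_prop)
      (measurable_abs_cos_rpow _)).stronglyMeasurable.stronglyMeasurableAtFilter
  · exact continuous_sqrt_delta.continuousAt.mul (continuousAt_abs_cos_rpow _ hx)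

omit hq0 hq1 in
lemma continuous_E1 : Continuous (E1 p q) :=
  intervalIntegral.continuous_primitive (intervalIntegrable_E1 hp1 hp2) 0

lemma expanding_F1 {x y : ℝ} (hxy : x ≤ y) : y - x ≤ F1 p q y - F1 p q x := by
  refine expanding_integral (intervalIntegrable_F1 hp1 hp2 hq0 hq1) ?_ hxy
  -- For `p < 2` the integrand takes the default value `0` at the zeros of the cosine, so the lower
  -- bound `1` holds only almost everywhere.
  filter_upwards [countable_cos_eq_zero.ae_notMem volume] with x hx
  have h2 : 1 ≤ 2 / p := by rw [le_div_iff₀] <;> linarith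
  rw [le_div_iff₀ (sqrt_delta_pos hq0 hq1 x), one_mul]
  calc √(1 - q ^ 2 * Real.sin x ^ 2) ≤ 1 := Real.sqrt_le_one.2 (one_sub_sq_mul_sin_sq_le_one x)
    _ ≤ _ := Real.one_le_rpow_of_pos_of_le_one_of_nonpos (abs_pos.2 hx) (Real.abs_cos_le_one x)
      (by linarith)

lemma surjOn_F1 : SurjOn (F1 p q) univ univ :=
  surjOn_univ_of_expanding
    (intervalIntegral.continuous_primitive (intervalIntegrable_F1 hp1 hp2 hq0 hq1) 0)
    fun _ _ => expanding_F1 hp1 hp2 hq0 hq1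

omit hp1 hp2 hq0 in
lemma am1_eq : am1 p q = Function.invFunOn (F1 p q) univ := by
  rw [am1, amplitudeDomain, if_neg hq1.ne]

lemma continuous_am1 : Continuous (am1 p q) := by
  rw [am1_eq hq1]
  exact continuous_invFunOn (surjOn_F1 hp1 hp2 hq0 hq1)
    fun _ _ _ _ => expanding_F1 hp1 hp2 hq0 hq1

lemma countable_cos_am1_eq_zero : {s | Real.cos (am1 p q s) = 0}.Countable := by
  rw [am1_eq hq1]
  exact countable_cos_eq_zero.preimage (injective_invFunOn (surjOn_F1 hp1 hp2 hq0 hq1))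

/-- The inverse function rule applies off the zeros of the cosine; the formula is continuous, as
`2/p - 1 ≥ 0`, and therefore persists at those zeros. For `p < 2` it vanishes there, which is the
degeneracy of the wavelike case. -/
lemma hasDerivAt_am1 (s : ℝ) :
    HasDerivAt (am1 p q)
      (√(1 - q ^ 2 * Real.sin (am1 p q s) ^ 2) * |Real.cos (am1 p q s)| ^ (2 / p - 1)) s := by
  have h2 : 1 ≤ 2 / p := by rw [le_div_iff₀] <;> linarith
  have hc := continuous_am1 hp1 hp2 hq0 hq1
  refine hasDerivAt_of_off_countable (countable_cos_am1_eq_zero hp1 hp2 hq0 hq1) hc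
    (g := fun s => √(1 - q ^ 2 * Real.sin (am1 p q s) ^ 2)
      * |Real.cos (am1 p q s)| ^ (2 / p - 1)) ?_ ?_ s
  · refine (continuous_sqrt_delta.comp hc).mul ?_
    exact ((Real.continuous_cos.comp hc).abs).rpow_const fun _ => Or.inr (by linarith)
  · intro s hs
    have h0 : Real.cos (am1 p q s) ≠ 0 := hs
    have hd := hasDerivAt_F1 hp1 hp2 hq0 hq1 h0
    have hpos := sqrt_delta_pos hq0 hq1 (am1 p q s)
    have hpos' : 0 < |Real.cos (am1 p q s)| ^ (1 - 2 / p) :=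
      Real.rpow_pos_of_pos (abs_pos.2 h0) _
    have := hasDerivAt_invFunOn (s := s) (surjOn_F1 hp1 hp2 hq0 hq1)
      (fun _ _ _ _ => expanding_F1 hp1 hp2 hq0 hq1) (by rw [← am1_eq hq1]; exact hd)
      (div_pos hpos' hpos).ne'
    rw [← am1_eq hq1] at this
    refine this.congr_deriv ?_
    rw [inv_div, div_eq_mul_inv, ← Real.rpow_neg (abs_nonneg _), neg_sub]

end Wavelike

/-! ### The wavelike profile -/

lemma signPow_one_mul_of_neg {a C x : ℝ} (hC : 0 < C) :
    signPow 1 a (-(C * x)) = -(C ^ a * signPow 1 a x) := by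
  rw [signPow, signPow, abs_neg, abs_mul, abs_of_pos hC, Real.mul_rpow hC.le (abs_nonneg _),
    pow_one, pow_one, neg_div, mul_div_mul_left _ _ hC.ne']
  ring

lemma signPow_one_signPow_one {a e x : ℝ} :
    signPow 1 a (signPow 1 e x) = signPow 1 (e * a) x := by
  rcases eq_or_ne x 0 with rfl | hx
  · simp [signPow]
  · have h1 : |signPow 1 e x| = |x| ^ e := abs_signPow 1 e hx
    have hpos : 0 < |x| ^ e := Real.rpow_pos_of_pos (abs_pos.2 hx) _
    rw [signPow, h1, signPow, signPow, ← Real.rpow_mul (abs_nonneg _), pow_one, pow_one,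
      mul_div_assoc, div_self hpos.ne', mul_one]

lemma abs_rpow_mul_self_eq_signPow (b x : ℝ) : |x| ^ b * x = signPow 1 (b + 1) x := by
  rcases eq_or_ne x 0 with rfl | hx
  · simp [signPow]
  · rw [signPow, pow_one, Real.rpow_add_one (abs_ne_zero.2 hx)]
    field_simp [abs_ne_zero.2 hx]

/-- The first component of the tangent of the wavelike profile. -/
def wavelikeCos (p q s : ℝ) : ℝ := 1 - 2 * q ^ 2 * Real.sin (am1 p q s) ^ 2

/-- The second component of the tangent of the wavelike profile. -/
def wavelikeSin (p q s : ℝ) : ℝ :=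
  2 * q * Real.sin (am1 p q s) * √(1 - q ^ 2 * Real.sin (am1 p q s) ^ 2)

/-- The height of the wavelike profile. -/
def wavelikeHeight (p q s : ℝ) : ℝ := -(q * (p / (p - 1)) * (|cn p q s| ^ (p - 2) * cn p q s))

lemma cn_eq_signPow (s : ℝ) : cn p q s = signPow 1 (2 / p) (Real.cos (am1 p q s)) := by
  rw [cn, abs_rpow_mul_self_eq_signPow]; ring_nf

section

variable (hp1 : 1 < p)
include hp1

lemma wavelikeHeight_eq_signPow (s : ℝ) : wavelikeHeight p q s =
    -(q * (p / (p - 1)) * signPow 1 (2 - 2 / p) (Real.cos (am1 p q s))) := by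
  have hp0 : p ≠ 0 := by linarith
  have hp1' : p - 1 ≠ 0 := by linarith
  rw [wavelikeHeight, abs_rpow_mul_self_eq_signPow, cn_eq_signPow,
    signPow_one_signPow_one,
    show 2 / p * (p - 2 + 1) = 2 - 2 / p by field_simp; ring]

/-- The exponents match since `(2 - 2/p)/(p - 1) = 2/p`. Hence the curvature, a multiple of `cn`, is
a signed power of the height, which closes the system for the curve. -/
lemma signPow_wavelikeHeight (hq0 : 0 < q) (s : ℝ) :
    signPow 1 (1 / (p - 1)) (wavelikeHeight p q s) =
      -((q * (p / (p - 1))) ^ (1 / (p - 1)) * cn p q s) := by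
  have hp0 : p ≠ 0 := by linarith
  have hp1' : 0 < p - 1 := by linarith
  rw [wavelikeHeight_eq_signPow hp1, signPow_one_mul_of_neg (by positivity),
    signPow_one_signPow_one, cn_eq_signPow,
    show (2 - 2 / p) * (1 / (p - 1)) = 2 / p by field_simp]

lemma wavelikeHeight_eq_zero_iff (hq0 : 0 < q) (s : ℝ) :
    wavelikeHeight p q s = 0 ↔ Real.cos (am1 p q s) = 0 := by
  have hp1' : 0 < p - 1 := by linarith
  constructor
  · intro h
    by_contra h0
    have h1 : signPow 1 (2 - 2 / p) (Real.cos (am1 p q s)) ≠ 0 := by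
      rw [← abs_pos, abs_signPow _ _ h0]
      exact Real.rpow_pos_of_pos (abs_pos.2 h0) _
    rw [wavelikeHeight_eq_signPow hp1, neg_eq_zero] at h
    exact mul_ne_zero (by positivity) h1 h
  · intro h
    simp [wavelikeHeight, cn, h]

end

lemma wavelikeCos_sq_add_wavelikeSin_sq (hq0 : 0 < q) (hq1 : q < 1) (s : ℝ) :
    wavelikeCos p q s ^ 2 + wavelikeSin p q s ^ 2 = 1 := by
  rw [wavelikeCos, wavelikeSin, mul_pow, Real.sq_sqrt (one_sub_sq_mul_sin_sq_pos hq0 hq1 _).le]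
  ring

section

variable (hp1 : 1 < p) (hp2 : p ≤ 2) (hq0 : 0 < q) (hq1 : q < 1)
include hp1 hp2 hq0 hq1

lemma hasDerivAt_sin_am1 (s : ℝ) : HasDerivAt (fun s => Real.sin (am1 p q s))
    (cn p q s * √(1 - q ^ 2 * Real.sin (am1 p q s) ^ 2)) s := by
  refine (hasDerivAt_am1 hp1 hp2 hq0 hq1 s).sin.congr_deriv ?_
  rw [cn]; ring

/-- For the tangent angle `θ` with `sin(θ/2) = q sin am` and `cos(θ/2) > 0`, this formula and the
one for the sine express `θ' = 2 q cn`. -/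
lemma hasDerivAt_wavelikeCos (s : ℝ) :
    HasDerivAt (wavelikeCos p q) (-(2 * q * cn p q s * wavelikeSin p q s)) s := by
  have h := (((hasDerivAt_sin_am1 hp1 hp2 hq0 hq1 s).fun_pow 2).const_mul (2 * q ^ 2)).const_sub 1
  refine h.congr_deriv ?_
  rw [wavelikeSin]
  push_cast
  ring

lemma hasDerivAt_wavelikeSin (s : ℝ) :
    HasDerivAt (wavelikeSin p q) (2 * q * cn p q s * wavelikeCos p q s) s := by
  have h1 := hasDerivAt_sin_am1 hp1 hp2 hq0 hq1 s
  have hpos := one_sub_sq_mul_sin_sq_pos hq0 hq1 (am1 p q s)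
  have h2 := (((h1.fun_pow 2).const_mul (q ^ 2)).const_sub 1).sqrt hpos.ne'
  refine ((h1.const_mul (2 * q)).fun_mul h2).congr_deriv ?_
  have hD := Real.sq_sqrt hpos.le
  have hD0 := (Real.sqrt_pos.2 hpos).ne'
  rw [wavelikeCos]
  set D := √(1 - q ^ 2 * Real.sin (am1 p q s) ^ 2)
  push_cast
  field_simp
  rw [hD]
  ring

lemma continuous_wavelikeCos : Continuous (wavelikeCos p q) :=
  continuous_iff_continuousAt.2 fun s => (hasDerivAt_wavelikeCos hp1 hp2 hq0 hq1 s).continuousAt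

lemma continuous_wavelikeSin : Continuous (wavelikeSin p q) :=
  continuous_iff_continuousAt.2 fun s => (hasDerivAt_wavelikeSin hp1 hp2 hq0 hq1 s).continuousAt

/-- The powers of the cosine coming from `E1` and from the amplitude cancel off its zeros, and what
remains is continuous. -/
lemma hasDerivAt_wavelikeAbscissa (s : ℝ) :
    HasDerivAt (fun s => 2 * E1 p q (am1 p q s) - s) (wavelikeCos p q s) s := by
  refine hasDerivAt_of_off_countable (countable_cos_am1_eq_zero hp1 hp2 hq0 hq1)
    (((continuous_E1 hp1 hp2).comp (continuous_am1 hp1 hp2 hq0 hq1)).const_mul 2 |>.sub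
      continuous_id) (continuous_wavelikeCos hp1 hp2 hq0 hq1) (fun s hs => ?_) s
  have h0 : Real.cos (am1 p q s) ≠ 0 := hs
  have h1 := (hasDerivAt_E1 (q := q) hp1 hp2 h0).comp s (hasDerivAt_am1 hp1 hp2 hq0 hq1 s)
  refine ((h1.const_mul 2).sub (hasDerivAt_id s)).congr_deriv ?_
  have hD := Real.mul_self_sqrt (one_sub_sq_mul_sin_sq_pos hq0 hq1 (am1 p q s)).le
  have hc : |Real.cos (am1 p q s)| ^ (1 - 2 / p) * |Real.cos (am1 p q s)| ^ (2 / p - 1) = 1 := by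
    rw [← Real.rpow_add (abs_pos.2 h0)]; simp
  rw [wavelikeCos]
  set D := √(1 - q ^ 2 * Real.sin (am1 p q s) ^ 2)
  linear_combination 2 * D * D * hc + 2 * hD

lemma hasDerivAt_wavelikeHeight (s : ℝ) :
    HasDerivAt (wavelikeHeight p q) (wavelikeSin p q s) s := by
  have hp0 : p ≠ 0 := by linarith
  have hp1' : p - 1 ≠ 0 := by linarith
  have hlt : 2 / p < 2 := by rw [div_lt_iff₀] <;> linarith
  have hfun : wavelikeHeight p q = fun s =>
      -(q * (p / (p - 1)) * signPow 1 (2 - 2 / p) (Real.cos (am1 p q s))) :=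
    funext (wavelikeHeight_eq_signPow hp1)
  rw [hfun]
  refine hasDerivAt_of_off_countable (countable_cos_am1_eq_zero hp1 hp2 hq0 hq1)
    ((((continuous_signPow 1 (by linarith)).comp (Real.continuous_cos.comp
      (continuous_am1 hp1 hp2 hq0 hq1))).const_mul _).neg)
    (continuous_wavelikeSin hp1 hp2 hq0 hq1) (fun s hs => ?_) s
  have h0 : Real.cos (am1 p q s) ≠ 0 := hs
  have h1 := (hasDerivAt_signPow 1 (2 - 2 / p) h0).comp s (hasDerivAt_am1 hp1 hp2 hq0 hq1 s).cos
  refine ((h1.const_mul (q * (p / (p - 1)))).neg).congr_deriv ?_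
  have hc : |Real.cos (am1 p q s)| ^ (1 - 2 / p) * |Real.cos (am1 p q s)| ^ (2 / p - 1) = 1 := by
    rw [← Real.rpow_add (abs_pos.2 h0)]; simp
  have hsq : (Real.cos (am1 p q s) / |Real.cos (am1 p q s)|) ^ (1 + 1) = 1 := by
    rw [one_add_one_eq_two, div_pow, sq_abs, div_self (pow_ne_zero 2 h0)]
  have hcoef : q * (p / (p - 1)) * (2 - 2 / p) = 2 * q := by field_simp
  rw [signPow, hsq, show 2 - 2 / p - 1 = 1 - 2 / p by ring, wavelikeSin]
  set D := √(1 - q ^ 2 * Real.sin (am1 p q s) ^ 2)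
  set c := |Real.cos (am1 p q s)| ^ (1 - 2 / p)
  set c' := |Real.cos (am1 p q s)| ^ (2 / p - 1)
  linear_combination (q * (p / (p - 1)) * (2 - 2 / p)) * Real.sin (am1 p q s) * D * hc
    + Real.sin (am1 p q s) * D * hcoef

omit hp2 in
-- At such a point the sine of the amplitude is `±1`. Since this quantity is the derivative of the
-- height, the height has only simple zeros.
lemma wavelikeSin_ne_zero_of_height_eq_zero {s : ℝ} (h : wavelikeHeight p q s = 0) :
    wavelikeSin p q s ≠ 0 := by
  rw [wavelikeHeight_eq_zero_iff hp1 hq0] at h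
  have : Real.sin (am1 p q s) ≠ 0 := fun h' => by
    have := Real.sin_sq_add_cos_sq (am1 p q s)
    rw [h, h'] at this
    norm_num at this
  exact mul_ne_zero (mul_ne_zero (by positivity) this) (sqrt_delta_pos hq0 hq1 _).ne'

lemma countable_wavelikeHeight_eq_zero : {s | wavelikeHeight p q s = 0}.Countable := by
  simp only [wavelikeHeight_eq_zero_iff hp1 hq0]
  exact countable_cos_am1_eq_zero hp1 hp2 hq0 hq1

/-! ### Analyticity of the wavelike profile -/

lemma analyticAt_am1 {s : ℝ} (h0 : Real.cos (am1 p q s) ≠ 0) : AnalyticAt ℝ (am1 p q) s := by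
  refine analyticAt_of_autonomous (G := fun x => √(1 - q ^ 2 * Real.sin x ^ 2)
    * |Real.cos x| ^ (2 / p - 1)) (Eventually.of_forall (hasDerivAt_am1 hp1 hp2 hq0 hq1)) ?_
    (mul_pos (sqrt_delta_pos hq0 hq1 _) (Real.rpow_pos_of_pos (abs_pos.2 h0) _)).ne'
  refine (ContDiffAt.mul ?_ ?_).analyticAt
  · exact ContDiffAt.sqrt (by fun_prop) (one_sub_sq_mul_sin_sq_pos hq0 hq1 _).ne'
  · simp only [← Real.sqrt_sq_eq_abs]
    exact ContDiffAt.rpow_const_of_ne (ContDiffAt.sqrt (by fun_prop) (pow_ne_zero 2 h0))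
      (Real.sqrt_ne_zero'.2 (by positivity))

omit hp2 hq1 in
-- Here `(2 - 2/p)(N + 1) = 2`, and `N + 1` is even, so all signs and absolute values disappear.
lemma cos_am1_sq_eq {N : ℕ} (hN : Odd N) (hpN : 1 / (p - 1) = N) (s : ℝ) :
    Real.cos (am1 p q s) ^ 2 = (wavelikeHeight p q s / (q * (p / (p - 1)))) ^ (N + 1) := by
  have hp0 : p ≠ 0 := by linarith
  have hp1' : p - 1 ≠ 0 := by linarith
  have hC : q * (p / (p - 1)) ≠ 0 := by
    have : 0 < p - 1 := by linarith
    positivity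
  rw [wavelikeHeight_eq_signPow hp1, neg_div, mul_div_cancel_left₀ _ hC, hN.add_one.neg_pow,
    ← hN.add_one.pow_abs]
  by_cases h0 : Real.cos (am1 p q s) = 0
  · simp [h0, signPow]
  · have he : (2 - 2 / p) * ((N + 1 : ℕ) : ℝ) = (2 : ℕ) := by
      push_cast
      rw [← hpN]
      field_simp
      ring
    rw [abs_signPow _ _ h0, ← Real.rpow_natCast (|Real.cos (am1 p q s)| ^ _),
      ← Real.rpow_mul (abs_nonneg _), he, Real.rpow_natCast, sq_abs]

lemma analyticAt_wavelikeCos_wavelikeSin {N : ℕ} (hN : Odd N) (hpN : 1 / (p - 1) = N) (s : ℝ) :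
    AnalyticAt ℝ (wavelikeCos p q) s ∧ AnalyticAt ℝ (wavelikeSin p q) s := by
  by_cases h0 : Real.cos (am1 p q s) = 0
  · have hC : 0 < q * (p / (p - 1)) := by
      have : 0 < p - 1 := by linarith
      positivity
    set C₀ := q * (p / (p - 1)) with hC₀
    have hsin1 : Real.sin (am1 p q s) ^ 2 = 1 := by
      have := Real.sin_sq_add_cos_sq (am1 p q s)
      rw [h0] at this
      linarith
    have hsin0 : Real.sin (am1 p q s) ≠ 0 := fun h => by rw [h] at hsin1; norm_num at hsin1
    have hsin2 : ∀ x, Real.sin (am1 p q x) ^ 2 = 1 - (wavelikeHeight p q x / C₀) ^ (N + 1) :=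
      fun x => by rw [hC₀, ← cos_am1_sq_eq hp1 hq0 hN hpN, Real.sin_sq]
    have hY0 : wavelikeHeight p q s = 0 := (wavelikeHeight_eq_zero_iff hp1 hq0 s).2 h0
    obtain ⟨τ, hτ, hτs⟩ : ∃ τ : ℝ, τ ≠ 0 ∧ ∀ᶠ x in 𝓝 s, Real.sin (am1 p q x) =
        τ * √(Real.sin (am1 p q x) ^ 2) := by
      have hc : ContinuousAt (fun x => Real.sin (am1 p q x)) s :=
        (hasDerivAt_sin_am1 hp1 hp2 hq0 hq1 s).continuousAt
      rcases lt_or_gt_of_ne hsin0 with h | h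
      · refine ⟨-1, by norm_num, ?_⟩
        filter_upwards [hc.eventually (gt_mem_nhds h)] with x hx
        rw [Real.sqrt_sq_eq_abs, abs_of_neg hx]; ring
      · refine ⟨1, by norm_num, ?_⟩
        filter_upwards [hc.eventually (lt_mem_nhds h)] with x hx
        rw [Real.sqrt_sq_eq_abs, abs_of_pos hx]; ring
    -- Near the zero, `sin am` is `τ = ±1` times the root of its square, which is a polynomial in
    -- the height. So `Y' = G(Y)`, where `G` is analytic at `0` (using `q < 1`) and non-zero there.
    set G : ℝ → ℝ := fun y => 2 * q * (τ * √(1 - (y / C₀) ^ (N + 1)))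
      * √(1 - q ^ 2 * (1 - (y / C₀) ^ (N + 1))) with hG
    have hGS : ∀ᶠ x in 𝓝 s, wavelikeSin p q x = G (wavelikeHeight p q x) := by
      filter_upwards [hτs] with x hx
      rw [hG, wavelikeSin, hx]
      simp only [mul_pow]
      rw [← hsin2, ← hx, ← mul_pow, ← hx]
    have hGa : AnalyticAt ℝ G (wavelikeHeight p q s) := by
      have h1 : 0 < 1 - q ^ 2 := by nlinarith
      refine (ContDiffAt.mul (contDiffAt_const.mul (contDiffAt_const.mul (ContDiffAt.sqrt ?_ ?_)))
        (ContDiffAt.sqrt ?_ ?_)).analyticAt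
      · fun_prop
      · simp [hY0]
      · fun_prop
      · simpa [hY0] using h1.ne'
    have hYa : AnalyticAt ℝ (wavelikeHeight p q) s := by
      refine analyticAt_of_autonomous (G := G) ?_ hGa ?_
      · filter_upwards [hGS] with x hx
        rw [← hx]
        exact hasDerivAt_wavelikeHeight hp1 hp2 hq0 hq1 x
      · rw [← hGS.self_of_nhds]
        exact wavelikeSin_ne_zero_of_height_eq_zero hp1 hq0 hq1 hY0
    constructor
    · have h1 : AnalyticAt ℝ
          (fun x => 1 - 2 * q ^ 2 * (1 - (wavelikeHeight p q x / C₀) ^ (N + 1))) s :=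
        analyticAt_const.sub (analyticAt_const.mul (analyticAt_const.sub
          ((hYa.div analyticAt_const hC.ne').pow _)))
      exact h1.congr (Eventually.of_forall fun x => by simp only [wavelikeCos, hsin2])
    · exact (hGa.comp hYa).congr (hGS.mono fun x hx => hx.symm)
  · have ha := (analyticAt_am1 hp1 hp2 hq0 hq1 h0).contDiffAt (n := ω)
    have hs : ContDiffAt ℝ ω (fun x => Real.sin (am1 p q x)) s := ha.sin
    constructor
    · exact (contDiffAt_const.sub (contDiffAt_const.mul (hs.pow 2))).analyticAt
    · exact ((contDiffAt_const.mul hs).mul ((contDiffAt_const.sub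
        (contDiffAt_const.mul (hs.pow 2))).sqrt
          (one_sub_sq_mul_sin_sq_pos hq0 hq1 _).ne')).analyticAt

end

/-! ### The orbitlike profile -/

section Orbitlike

lemma continuous_delta_rpow (hq0 : 0 < q) (hq1 : q < 1) (b : ℝ) :
    Continuous fun x => (1 - q ^ 2 * Real.sin x ^ 2) ^ b :=
  Continuous.rpow_const (by fun_prop) fun x => Or.inl (one_sub_sq_mul_sin_sq_pos hq0 hq1 x).ne'

variable (hp1 : 1 < p) (hq0 : 0 < q) (hq1 : q < 1)
include hq0 hq1

lemma hasDerivAt_E2 (x : ℝ) :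
    HasDerivAt (E2 p q) ((1 - q ^ 2 * Real.sin x ^ 2) ^ (1 / p)) x :=
  ((continuous_delta_rpow hq0 hq1 _).integral_hasStrictDerivAt 0 x).hasDerivAt

lemma continuous_F2_integrand :
    Continuous fun x => 1 / (1 - q ^ 2 * Real.sin x ^ 2) ^ (1 / p) :=
  continuous_const.div (continuous_delta_rpow hq0 hq1 _) fun x =>
    (Real.rpow_pos_of_pos (one_sub_sq_mul_sin_sq_pos hq0 hq1 x) _).ne'

lemma hasDerivAt_F2 (x : ℝ) :
    HasDerivAt (F2 p q) (1 / (1 - q ^ 2 * Real.sin x ^ 2) ^ (1 / p)) x :=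
  ((continuous_F2_integrand hq0 hq1).integral_hasStrictDerivAt 0 x).hasDerivAt

include hp1

lemma expanding_F2 {x y : ℝ} (hxy : x ≤ y) : y - x ≤ F2 p q y - F2 p q x := by
  refine expanding_integral (fun x y => (continuous_F2_integrand hq0 hq1).intervalIntegrable x y)
    (Eventually.of_forall fun x => ?_) hxy
  have hpos := one_sub_sq_mul_sin_sq_pos hq0 hq1 x
  rw [le_div_iff₀ (Real.rpow_pos_of_pos hpos _), one_mul]
  exact Real.rpow_le_one hpos.le (one_sub_sq_mul_sin_sq_le_one x) (by positivity)

lemma hasDerivAt_am2 (s : ℝ) :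
    HasDerivAt (am2 p q) ((1 - q ^ 2 * Real.sin (am2 p q s) ^ 2) ^ (1 / p)) s := by
  have hpos : 0 < (1 - q ^ 2 * Real.sin (am2 p q s) ^ 2) ^ (1 / p) :=
    Real.rpow_pos_of_pos (one_sub_sq_mul_sin_sq_pos hq0 hq1 _) _
  have heq : am2 p q = Function.invFunOn (F2 p q) univ := by
    rw [am2, amplitudeDomain, if_neg hq1.ne]
  have hexp : ∀ x y, x ≤ y → y - x ≤ F2 p q y - F2 p q x := fun _ _ => expanding_F2 hp1 hq0 hq1
  have h := hasDerivAt_invFunOn (s := s)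
    (surjOn_univ_of_expanding (continuous_iff_continuousAt.2
      fun x => (hasDerivAt_F2 hq0 hq1 x).continuousAt) hexp) (fun x _ y _ => hexp x y)
    (by rw [← heq]; exact hasDerivAt_F2 hq0 hq1 _) (one_div_pos.2 hpos).ne'
  rw [← heq] at h
  simpa using h

/-- As `q < 1`, the right-hand side of the amplitude equation is positive everywhere, so there is no
degenerate point. -/
lemma analyticAt_am2 (s : ℝ) : AnalyticAt ℝ (am2 p q) s := by
  have hpos := one_sub_sq_mul_sin_sq_pos hq0 hq1 (am2 p q s)
  have hG : ContDiffAt ℝ ω (fun x => (1 - q ^ 2 * Real.sin x ^ 2) ^ (1 / p)) (am2 p q s) :=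
    ContDiffAt.rpow_const_of_ne (by fun_prop) hpos.ne'
  exact analyticAt_of_autonomous (Eventually.of_forall (hasDerivAt_am2 hp1 hq0 hq1)) hG.analyticAt
    (Real.rpow_pos_of_pos hpos _).ne'

/-- The exponents in `E2` and in the amplitude equation are conjugate, so their powers multiply to
`1 - q² sin²`. The resulting tangent angle is twice the amplitude. -/
lemma hasDerivAt_orbitlikeAbscissa (s : ℝ) :
    HasDerivAt (fun s => 1 / q ^ 2 * (2 * E2 (p / (p - 1)) q (am2 p q s) + (q ^ 2 - 2) * s))
      (1 - 2 * Real.sin (am2 p q s) ^ 2) s := by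
  have hpos := one_sub_sq_mul_sin_sq_pos hq0 hq1 (am2 p q s)
  have h1 := (hasDerivAt_E2 (p := p / (p - 1)) hq0 hq1 (am2 p q s)).comp s
    (hasDerivAt_am2 hp1 hq0 hq1 s)
  refine (((h1.const_mul 2).add ((hasDerivAt_id s).const_mul (q ^ 2 - 2))).const_mul
    (1 / q ^ 2)).congr_deriv ?_
  have hp0 : p ≠ 0 := by linarith
  have hp1' : p - 1 ≠ 0 := by linarith
  rw [← Real.rpow_add hpos, show 1 / (p / (p - 1)) + 1 / p = 1 by field_simp; ring, Real.rpow_one]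
  field_simp
  ring

lemma hasDerivAt_orbitlikeHeight (s : ℝ) :
    HasDerivAt (fun s => 1 / q ^ 2 * -(p / (p - 1) * dn p q s ^ (p - 1)))
      (2 * Real.sin (am2 p q s) * Real.cos (am2 p q s)) s := by
  have hpos := one_sub_sq_mul_sin_sq_pos hq0 hq1 (am2 p q s)
  have hp0 : p ≠ 0 := by linarith
  have hp1' : p - 1 ≠ 0 := by linarith
  have hdn : ∀ s, dn p q s ^ (p - 1) = (1 - q ^ 2 * Real.sin (am2 p q s) ^ 2) ^ (1 - 1 / p) :=
    fun s => by
      rw [dn, ← Real.rpow_mul (one_sub_sq_mul_sin_sq_pos hq0 hq1 _).le]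
      congr 1
      field_simp
  simp only [hdn]
  have h1 := ((((hasDerivAt_am2 hp1 hq0 hq1 s).sin.fun_pow 2).const_mul (q ^ 2)).const_sub
    1).rpow_const (p := 1 - 1 / p) (Or.inl hpos.ne')
  refine (((h1.const_mul (p / (p - 1))).neg).const_mul (1 / q ^ 2)).congr_deriv ?_
  have hc : (1 - q ^ 2 * Real.sin (am2 p q s) ^ 2) ^ (1 / p) *
      (1 - q ^ 2 * Real.sin (am2 p q s) ^ 2) ^ (1 - 1 / p - 1) = 1 := by
    rw [← Real.rpow_add hpos]; simp
  set u := (1 - q ^ 2 * Real.sin (am2 p q s) ^ 2) ^ (1 / p)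
  set v := (1 - q ^ 2 * Real.sin (am2 p q s) ^ 2) ^ (1 - 1 / p - 1)
  have hcoef : p / (p - 1) * (1 - 1 / p) = 1 := by field_simp
  have hq : 1 / q ^ 2 * q ^ 2 = 1 := by field_simp
  push_cast
  rw [pow_one]
  set S := Real.sin (am2 p q s)
  set C := Real.cos (am2 p q s)
  linear_combination (2 * S * C) * (1 / q ^ 2 * q ^ 2 * (p / (p - 1) * (1 - 1 / p)) * hc
    + 1 / q ^ 2 * q ^ 2 * hcoef + hq)

lemma analyticOn_of_isOrbitlike_profile {L : ℝ} (hL : 0 < L) {γ : ℝ → Plane}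
    (harc : IsArclength L γ) (h : IsRepresentedBy L γ (orbitlikeProfile p q)) :
    AnalyticOn ℝ γ (Icc 0 L) := by
  have heq : orbitlikeProfile p q = fun s =>
      !₂[1 / q ^ 2 * (2 * E2 (p / (p - 1)) q (am2 p q s) + (q ^ 2 - 2) * s),
        1 / q ^ 2 * -(p / (p - 1) * dn p q s ^ (p - 1))] := by
    funext s
    ext i
    fin_cases i <;> simp [orbitlikeProfile]
  rw [heq] at h
  have ha : ∀ s, ContDiffAt ℝ ω (am2 p q) s := fun s => (analyticAt_am2 hp1 hq0 hq1 s).contDiffAt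
  refine analyticOn_of_isRepresentedBy hL harc h (hasDerivAt_orbitlikeAbscissa hp1 hq0 hq1)
    (hasDerivAt_orbitlikeHeight hp1 hq0 hq1) (fun s => ?_) (fun s => ?_) (fun s => ?_)
  · linear_combination 4 * Real.sin (am2 p q s) ^ 2 * Real.sin_sq_add_cos_sq (am2 p q s)
  · exact (contDiffAt_const.sub (contDiffAt_const.mul ((ha s).sin.pow 2))).analyticAt
  · exact ((contDiffAt_const.mul (ha s).sin).mul (ha s).cos).analyticAt

end Orbitlike

/-! ### The borderline profile -/

section Borderline

lemma F1_integrand_one_eq {x : ℝ} (hx : 0 < Real.cos x) :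
    |Real.cos x| ^ (1 - 2 / p) / √(1 - 1 ^ 2 * Real.sin x ^ 2) = Real.cos x ^ (-(2 / p)) := by
  rw [one_pow, one_mul, ← Real.cos_sq', Real.sqrt_sq hx.le, abs_of_pos hx,
    ← Real.rpow_sub_one hx.ne']
  ring_nf

lemma cos_pos_of_mem_uIcc {x y t : ℝ} (hx : x ∈ Ioo (-(Real.pi / 2)) (Real.pi / 2))
    (hy : y ∈ Ioo (-(Real.pi / 2)) (Real.pi / 2)) (ht : t ∈ uIcc x y) : 0 < Real.cos t :=
  Real.cos_pos_of_mem_Ioo (ordConnected_Ioo.uIcc_subset hx hy ht)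

lemma intervalIntegrable_F1_one {x y : ℝ} (hx : x ∈ Ioo (-(Real.pi / 2)) (Real.pi / 2))
    (hy : y ∈ Ioo (-(Real.pi / 2)) (Real.pi / 2)) : IntervalIntegrable
      (fun θ => |Real.cos θ| ^ (1 - 2 / p) / √(1 - 1 ^ 2 * Real.sin θ ^ 2)) volume x y := by
  refine ContinuousOn.intervalIntegrable (ContinuousOn.congr (f := fun θ => Real.cos θ ^ (-(2 / p)))
    ?_ fun t ht => F1_integrand_one_eq (cos_pos_of_mem_uIcc hx hy ht))
  exact ContinuousOn.rpow_const (by fun_prop) fun t ht => Or.inl (cos_pos_of_mem_uIcc hx hy ht).ne'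

lemma zero_mem_Ioo_pi : (0 : ℝ) ∈ Ioo (-(Real.pi / 2)) (Real.pi / 2) := by
  constructor <;> linarith [Real.pi_pos]

lemma hasDerivAt_F1_one {x : ℝ} (hx : x ∈ Ioo (-(Real.pi / 2)) (Real.pi / 2)) :
    HasDerivAt (F1 p 1) (Real.cos x ^ (-(2 / p))) x := by
  have hc := Real.cos_pos_of_mem_Ioo hx
  rw [← F1_integrand_one_eq hc]
  refine intervalIntegral.integral_hasDerivAt_right (intervalIntegrable_F1_one zero_mem_Ioo_pi hx)
    ?_ ?_
  · exact ((measurable_abs_cos_rpow _).div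
      (by fun_prop)).stronglyMeasurable.stronglyMeasurableAtFilter
  · refine (continuousAt_abs_cos_rpow _ hc.ne').div (by fun_prop) ?_
    rw [one_pow, one_mul, ← Real.cos_sq', Real.sqrt_sq hc.le]
    exact hc.ne'

lemma F1_neg (x : ℝ) : F1 p q (-x) = -F1 p q x := by
  have h := intervalIntegral.integral_comp_neg (a := 0) (b := x)
    (fun θ => |Real.cos θ| ^ (1 - 2 / p) / √(1 - q ^ 2 * Real.sin θ ^ 2))
  simp only [Real.cos_neg, Real.sin_neg, neg_sq, neg_zero] at h
  rw [F1, F1, h, intervalIntegral.integral_symm]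

variable (hp1 : 1 < p) (hp2 : p ≤ 2)
include hp1 hp2

lemma inv_cos_le {x : ℝ} (hx : 0 < Real.cos x) : (Real.cos x)⁻¹ ≤ Real.cos x ^ (-(2 / p)) := by
  have h2 : 1 ≤ 2 / p := by rw [le_div_iff₀] <;> linarith
  rw [← Real.rpow_neg_one]
  exact Real.rpow_le_rpow_of_exponent_ge hx (Real.cos_le_one x) (by linarith)

lemma expanding_F1_one {x y : ℝ} (hx : x ∈ Ioo (-(Real.pi / 2)) (Real.pi / 2))
    (hy : y ∈ Ioo (-(Real.pi / 2)) (Real.pi / 2)) (hxy : x ≤ y) : y - x ≤ F1 p 1 y - F1 p 1 x := by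
  rw [F1, F1, intervalIntegral.integral_interval_sub_left
    (intervalIntegrable_F1_one zero_mem_Ioo_pi hy) (intervalIntegrable_F1_one zero_mem_Ioo_pi hx)]
  calc y - x = ∫ _ in x..y, (1 : ℝ) := by simp
    _ ≤ _ := intervalIntegral.integral_mono_on hxy intervalIntegrable_const
      (intervalIntegrable_F1_one hx hy) fun t ht => ?_
  have hc := cos_pos_of_mem_uIcc hx hy (Icc_subset_uIcc ht)
  rw [F1_integrand_one_eq hc]
  exact (one_le_inv_iff₀.2 ⟨hc, Real.cos_le_one t⟩).trans (inv_cos_le hp1 hp2 hc)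

/-- As `p ≤ 2`, the integrand is at least `1/cos`, hence at least `tan = (-log cos)'`. So the
integral diverges at `π/2`, and the amplitude is defined on the whole line. -/
lemma neg_log_cos_le_F1_one {x : ℝ} (hx0 : 0 ≤ x) (hx : x < Real.pi / 2) :
    -Real.log (Real.cos x) ≤ F1 p 1 x := by
  have hmem : ∀ t ∈ Icc 0 x, t ∈ Ioo (-(Real.pi / 2)) (Real.pi / 2) := fun t ht =>
    ⟨by linarith [ht.1, Real.pi_pos], by linarith [ht.2]⟩
  have hd : ∀ t ∈ Icc 0 x, HasDerivAt (fun t => F1 p 1 t + Real.log (Real.cos t))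
      (Real.cos t ^ (-(2 / p)) + -Real.sin t / Real.cos t) t := fun t ht =>
    (hasDerivAt_F1_one (hmem t ht)).add
      ((Real.hasDerivAt_cos t).log (Real.cos_pos_of_mem_Ioo (hmem t ht)).ne')
  have hmono : MonotoneOn (fun t => F1 p 1 t + Real.log (Real.cos t)) (Icc 0 x) := by
    refine monotoneOn_of_deriv_nonneg (convex_Icc 0 x)
      (fun t ht => (hd t ht).continuousAt.continuousWithinAt)
      (fun t ht => (hd t (interior_subset ht)).differentiableAt.differentiableWithinAt)
      fun t ht => ?_
    have hc := Real.cos_pos_of_mem_Ioo (hmem t (interior_subset ht))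
    rw [(hd t (interior_subset ht)).deriv, neg_div, ← sub_eq_add_neg, sub_nonneg]
    refine le_trans ?_ (inv_cos_le hp1 hp2 hc)
    rw [div_le_iff₀ hc, inv_mul_cancel₀ hc.ne']
    exact Real.sin_le_one t
  have := hmono (left_mem_Icc.2 hx0) (right_mem_Icc.2 hx0) hx0
  simp only [Real.cos_zero, Real.log_one, add_zero] at this
  have h0 : F1 p 1 0 = 0 := by simp [F1]
  linarith

lemma surjOn_F1_one : SurjOn (F1 p 1) (Ioo (-(Real.pi / 2)) (Real.pi / 2)) univ := by
  have hpos : ∀ s : ℝ, 0 ≤ s → ∃ x ∈ Ioo (-(Real.pi / 2)) (Real.pi / 2), F1 p 1 x = s := by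
    intro s hs
    have he : 0 < Real.exp (-s) := Real.exp_pos _
    have he1 : Real.exp (-s) ≤ 1 := Real.exp_le_one_iff.2 (by linarith)
    -- Chosen so that `-log (cos x) = s`; the logarithmic bound then puts `s` below the value at
    -- `x`, and the intermediate value theorem applies.
    set x := Real.arccos (Real.exp (-s)) with hx
    have hx0 : 0 ≤ x := Real.arccos_nonneg _
    have hx1 : x < Real.pi / 2 := Real.arccos_lt_pi_div_two.2 he
    have hle := neg_log_cos_le_F1_one hp1 hp2 hx0 hx1
    rw [hx, Real.cos_arccos (by linarith) he1, Real.log_exp, neg_neg, ← hx] at hle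
    have hmem : ∀ t ∈ Icc 0 x, t ∈ Ioo (-(Real.pi / 2)) (Real.pi / 2) := fun t ht =>
      ⟨by linarith [ht.1, Real.pi_pos], by linarith [ht.2]⟩
    have hivt := intermediate_value_Icc (f := F1 p 1) hx0
      fun t ht => (hasDerivAt_F1_one (hmem t ht)).continuousAt.continuousWithinAt
    have h0 : F1 p 1 0 = 0 := by simp [F1]
    obtain ⟨t, ht, hts⟩ := hivt ⟨by rw [h0]; exact hs, hle⟩
    exact ⟨t, hmem t ht, hts⟩
  intro s _
  rcases le_total 0 s with h | h
  · exact hpos s h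
  · obtain ⟨x, hx, hxs⟩ := hpos (-s) (by linarith)
    exact ⟨-x, ⟨by linarith [hx.2], by linarith [hx.1]⟩, by rw [F1_neg, hxs, neg_neg]⟩

/-- The amplitude never leaves the open interval, so the zeros of the cosine that trouble the
wavelike case are not reached. -/
lemma cos_am1_one_pos (s : ℝ) : 0 < Real.cos (am1 p 1 s) := by
  rw [am1, amplitudeDomain, if_pos rfl]
  exact Real.cos_pos_of_mem_Ioo (invFunOn_spec (surjOn_F1_one hp1 hp2) s).1

lemma hasDerivAt_am1_one (s : ℝ) :
    HasDerivAt (am1 p 1) (Real.cos (am1 p 1 s) ^ (2 / p)) s := by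
  have hpos := cos_am1_one_pos hp1 hp2 s
  have heq : am1 p 1 = Function.invFunOn (F1 p 1) (Ioo (-(Real.pi / 2)) (Real.pi / 2)) := by
    rw [am1, amplitudeDomain, if_pos rfl]
  have hs := surjOn_F1_one hp1 hp2
  have h := hasDerivAt_invFunOn (s := s) hs (fun x hx y hy => expanding_F1_one hp1 hp2 hx hy)
    (hasDerivAt_F1_one (invFunOn_spec hs s).1)
    (by rw [← heq]; exact (Real.rpow_pos_of_pos hpos _).ne')
  rw [← heq] at h
  rwa [← Real.rpow_neg hpos.le, neg_neg] at h

lemma analyticAt_am1_one (s : ℝ) : AnalyticAt ℝ (am1 p 1) s := by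
  have hpos := cos_am1_one_pos hp1 hp2 s
  refine analyticAt_of_autonomous (G := fun x => Real.cos x ^ (2 / p))
    (Eventually.of_forall (hasDerivAt_am1_one hp1 hp2)) ?_ (Real.rpow_pos_of_pos hpos _).ne'
  exact (ContDiffAt.rpow_const_of_ne (by fun_prop) hpos.ne').analyticAt

lemma sech_eq (s : ℝ) : sech p s = Real.cos (am1 p 1 s) ^ (2 / p) := by
  have hpos := cos_am1_one_pos hp1 hp2 s
  rw [sech, cn, abs_of_pos hpos, ← Real.rpow_add_one hpos.ne', sub_add_cancel]

lemma hasDerivAt_borderlineAbscissa (s : ℝ) :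
    HasDerivAt (fun s => 2 * tanh p s - s) (2 * Real.cos (am1 p 1 s) ^ 2 - 1) s := by
  have hp0 : p ≠ 0 := by linarith
  have hfun : (fun t => sech p t ^ p) = fun t => Real.cos (am1 p 1 t) ^ 2 := by
    funext t
    rw [sech_eq hp1 hp2, ← Real.rpow_mul (cos_am1_one_pos hp1 hp2 t).le, div_mul_cancel₀ _ hp0,
      Real.rpow_two]
  have hcont : Continuous fun t => Real.cos (am1 p 1 t) ^ 2 :=
    (Real.continuous_cos.comp (continuous_iff_continuousAt.2
      fun t => (hasDerivAt_am1_one hp1 hp2 t).continuousAt)).pow 2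
  have h : HasDerivAt (tanh p) (Real.cos (am1 p 1 s) ^ 2) s := by
    have := (hcont.integral_hasStrictDerivAt 0 s).hasDerivAt
    rw [← hfun] at this
    exact this
  exact (h.const_mul 2).sub (hasDerivAt_id s)

lemma hasDerivAt_borderlineHeight (s : ℝ) :
    HasDerivAt (fun s => -(p / (p - 1) * sech p s ^ (p - 1)))
      (2 * Real.sin (am1 p 1 s) * Real.cos (am1 p 1 s)) s := by
  have hp0 : p ≠ 0 := by linarith
  have hp1' : p - 1 ≠ 0 := by linarith
  have hpos := cos_am1_one_pos hp1 hp2 s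
  have hse : ∀ s, sech p s ^ (p - 1) = Real.cos (am1 p 1 s) ^ (2 - 2 / p) := fun s => by
    rw [sech_eq hp1 hp2, ← Real.rpow_mul (cos_am1_one_pos hp1 hp2 s).le]
    congr 1
    field_simp
  simp only [hse]
  have h := (hasDerivAt_am1_one hp1 hp2 s).cos.rpow_const (p := 2 - 2 / p) (Or.inl hpos.ne')
  refine ((h.const_mul (p / (p - 1))).neg).congr_deriv ?_
  have hc : Real.cos (am1 p 1 s) ^ (2 / p) * Real.cos (am1 p 1 s) ^ (2 - 2 / p - 1) =
      Real.cos (am1 p 1 s) := by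
    rw [← Real.rpow_add hpos, show 2 / p + (2 - 2 / p - 1) = 1 by ring, Real.rpow_one]
  have hcoef : p / (p - 1) * (2 - 2 / p) = 2 := by field_simp
  linear_combination Real.sin (am1 p 1 s) * (p / (p - 1) * (2 - 2 / p) * hc
    + Real.cos (am1 p 1 s) * hcoef)

lemma analyticOn_of_isBorderline {L : ℝ} (hL : 0 < L) {γ : ℝ → Plane} (harc : IsArclength L γ)
    (h : IsBorderline p L γ) : AnalyticOn ℝ γ (Icc 0 L) := by
  have ha : ∀ s, ContDiffAt ℝ ω (am1 p 1) s := fun s => (analyticAt_am1_one hp1 hp2 s).contDiffAt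
  refine analyticOn_of_isRepresentedBy hL harc h (hasDerivAt_borderlineAbscissa hp1 hp2)
    (hasDerivAt_borderlineHeight hp1 hp2) (fun s => ?_) (fun s => ?_) (fun s => ?_)
  · linear_combination 4 * Real.cos (am1 p 1 s) ^ 2 * Real.sin_sq_add_cos_sq (am1 p 1 s)
  · exact ((contDiffAt_const.mul ((ha s).cos.pow 2)).sub contDiffAt_const).analyticAt
  · exact ((contDiffAt_const.mul (ha s).sin).mul (ha s).cos).analyticAt

end Borderline

/-! ### Regularity of wavelike curves -/

/-- Bootstrapping: a curve whose acceleration is a power of its height times a linear function of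
its velocity is as smooth as the power allows. -/
lemma contDiff_of_deriv_deriv_eq {E : Type*} [NormedAddCommGroup E] [NormedSpace ℝ E]
    {Γ T : ℝ → E} {ψ : ℝ → ℝ} {ℓ : E →L[ℝ] ℝ} {J : E →L[ℝ] E} {n : ℕ} (hψ : ContDiff ℝ n ψ)
    (hΓ : ∀ s, HasDerivAt Γ (T s) s) (hT : ∀ s, HasDerivAt T (ψ (ℓ (Γ s)) • J (T s)) s) :
    ContDiff ℝ (n + 2) Γ := by
  have hΓ' : deriv Γ = T := funext fun s => (hΓ s).deriv
  have hT' : deriv T = fun s => ψ (ℓ (Γ s)) • J (T s) := funext fun s => (hT s).deriv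
  have hstep : ∀ j : ℕ, ContDiff ℝ j T → ContDiff ℝ (j + 1) Γ := fun j h => by
    rw [contDiff_succ_iff_deriv, hΓ']
    exact ⟨fun s => (hΓ s).differentiableAt, by simp, h⟩
  -- If `T` is `C^j` then `Γ` is `C^(j+1)`, and the right-hand side of the equation for `T'` is
  -- `C^j` as long as `j ≤ n`.
  have key : ∀ j : ℕ, j ≤ n + 1 → ContDiff ℝ j T := by
    intro j
    induction j with
    | zero =>
      intro _
      rw [Nat.cast_zero, contDiff_zero]
      exact continuous_iff_continuousAt.2 fun s => (hT s).continuousAt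
    | succ j ih =>
      intro hj
      have h1 := ih (by omega)
      push_cast
      rw [contDiff_succ_iff_deriv, hT']
      refine ⟨fun s => (hT s).differentiableAt, by simp, ContDiff.smul ?_ (J.contDiff.comp h1)⟩
      exact (hψ.of_le (by norm_cast; omega)).comp
        (ℓ.contDiff.comp ((hstep j h1).of_le (by norm_cast; omega)))
  have := hstep (n + 1) (key (n + 1) le_rfl)
  push_cast at this
  rwa [add_assoc, one_add_one_eq_two] at this

/-- The rotation by a right angle. -/
def quarterTurn : Plane →L[ℝ] Plane :=
  LinearMap.toContinuousLinearMap
    { toFun := fun x => !₂[-(x 1), x 0]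
      map_add' := fun x y => by ext i; fin_cases i <;> simp; ring
      map_smul' := fun c x => by ext i; fin_cases i <;> simp }

lemma quarterTurn_apply (x : Plane) : quarterTurn x = !₂[-(x 1), x 0] := rfl

lemma norm_quarterTurn (x : Plane) : ‖quarterTurn x‖ = ‖x‖ := by
  rw [quarterTurn_apply, EuclideanSpace.norm_eq, EuclideanSpace.norm_eq]
  simp [Fin.sum_univ_two, add_comm]

lemma inner_quarterTurn (x : Plane) : inner ℝ x (quarterTurn x) = 0 := by
  rw [quarterTurn_apply]
  simp [PiLp.inner_apply, Fin.sum_univ_two]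
  ring

/-- The signed curvature of a curve that coincides on `[0, L]` with a twice differentiable curve of
acceleration `k U J T` and velocity `l U T`, `T` a unit vector. -/
lemma signedCurvature_ne_zero {L : ℝ} (hL : 0 < L) {γ γ₁ γ₂ γ₃ : ℝ → Plane}
    (hγ : ∀ s ∈ Icc 0 L, γ s = γ₁ s) (h₁ : ∀ s, HasDerivAt γ₁ (γ₂ s) s)
    (h₂ : ∀ s, HasDerivAt γ₂ (γ₃ s) s) {s : ℝ} (hs : s ∈ Icc 0 L) {U : Plane ≃ₗᵢ[ℝ] Plane}
    {T : Plane} (hT : ‖T‖ = 1) {k l : ℝ} (hk : k ≠ 0) (hl : l ≠ 0) (hv : γ₂ s = l • U T)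
    (ha : γ₃ s = k • U (quarterTurn T)) : signedCurvature L γ s ≠ 0 := by
  have hu : UniqueDiffOn ℝ (Icc 0 L) := uniqueDiffOn_Icc hL
  have hvel : ∀ s ∈ Icc 0 L, velocity L γ s = γ₂ s := fun s hs =>
    (((h₁ s).hasDerivWithinAt).congr hγ (hγ s hs)).derivWithin (hu s hs)
  have hacc : acceleration L γ s = γ₃ s :=
    (((h₂ s).hasDerivWithinAt).congr hvel (hvel s hs)).derivWithin (hu s hs)
  have hdet := det_sq_eq_one_of_orthonormal (x := U T) (y := U (quarterTurn T))
    (by rw [U.norm_map, hT]) (by rw [U.norm_map, norm_quarterTurn, hT])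
    (by rw [U.inner_map_map, inner_quarterTurn])
  have hdet0 : (U T) 0 * (U (quarterTurn T)) 1 - (U T) 1 * (U (quarterTurn T)) 0 ≠ 0 := fun h => by
    rw [h] at hdet; norm_num at hdet
  rw [signedCurvature, hvel s hs, hacc, hv, ha]
  refine div_ne_zero ?_ (pow_ne_zero _ ?_)
  · simp only [PiLp.smul_apply, smul_eq_mul]
    have : l * (U T) 0 * (k * (U (quarterTurn T)) 1) - l * (U T) 1 * (k * (U (quarterTurn T)) 0)
        = l * k * ((U T) 0 * (U (quarterTurn T)) 1 - (U T) 1 * (U (quarterTurn T)) 0) := by ring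
    rw [this]
    exact mul_ne_zero (mul_ne_zero hl hk) hdet0
  · rw [norm_ne_zero_iff]
    refine smul_ne_zero hl fun h => ?_
    have := U.norm_map T
    rw [h, hT] at this
    simp at this

/-- Near a zero of the curvature, the highest continuous derivative of a wavelike curve behaves as
a power of its height. -/
lemma IsWavelike.exists_iteratedDeriv_eq {p L : ℝ} (hp1 : 1 < p) (hp2 : p ≤ 2) (hL : 0 < L)
    {γ : ℝ → Plane} (harc : IsArclength L γ) (h : IsWavelike p L γ) {n : ℕ}
    (hn : n < 1 / (p - 1)) :
    ∃ (γ₁ : ℝ → Plane) (w : ℝ → ℝ) (V R : ℝ → Plane), (∀ s ∈ Icc 0 L, γ s = γ₁ s) ∧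
      ContDiff ℝ (n + 2) γ₁ ∧ ContDiff ℝ 1 w ∧ ContDiff ℝ 1 V ∧ ContDiff ℝ 1 R ∧
      (∀ s, w s = 0 → V s ≠ 0) ∧ (∀ s, w s = 0 → deriv w s ≠ 0) ∧ {s | w s = 0}.Countable ∧
      (∀ s ∈ curvatureZeroSet L γ, w s = 0) ∧
      iteratedDeriv (n + 2) γ₁ = fun s => signPow (1 + n) (1 / (p - 1) - n) (w s) • V s + R s := by
  obtain ⟨q, ⟨hq0, hq1⟩, h⟩ := h
  set a := 1 / (p - 1) with ha
  set Γ : ℝ → Plane := wavelikeProfile p q with hΓdef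
  set T : ℝ → Plane := fun s => !₂[wavelikeCos p q s, wavelikeSin p q s] with hTdef
  have hp1' : 0 < p - 1 := by linarith
  have hΓ : ∀ s, HasDerivAt Γ (T s) s := fun s => hasDerivAt_plane
    (hasDerivAt_wavelikeAbscissa hp1 hp2 hq0 hq1 s) (hasDerivAt_wavelikeHeight hp1 hp2 hq0 hq1 s)
  have hTn : ∀ s, ‖T s‖ = 1 := fun s =>
    norm_plane_eq_one (wavelikeCos_sq_add_wavelikeSin_sq hq0 hq1 s)
  -- Normalized so that `κ` times the signed power of the height is exactly `2 q cn`, the rotation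
  -- speed of the tangent.
  set κ : ℝ := -(2 * q) / (q * (p / (p - 1))) ^ a with hκ
  have hCa : 0 < (q * (p / (p - 1))) ^ a := by positivity
  have hκ0 : κ ≠ 0 := div_ne_zero (by simpa using hq0.ne') hCa.ne'
  set ℓ : Plane →L[ℝ] ℝ := EuclideanSpace.proj 1 with hℓ
  have hℓΓ : ∀ s, ℓ (Γ s) = wavelikeHeight p q s := fun s => by
    simp [hℓ, hΓdef, wavelikeProfile, wavelikeHeight]
  have hT : ∀ s, HasDerivAt T (signPow 1 a (ℓ (Γ s)) • (κ • quarterTurn) (T s)) s := fun s => by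
    refine (hasDerivAt_plane (hasDerivAt_wavelikeCos hp1 hp2 hq0 hq1 s)
      (hasDerivAt_wavelikeSin hp1 hp2 hq0 hq1 s)).congr_deriv ?_
    have e : signPow 1 a (wavelikeHeight p q s) * κ = 2 * q * cn p q s := by
      rw [signPow_wavelikeHeight hp1 hq0, ← ha, hκ, neg_mul_comm, neg_div, neg_neg, mul_right_comm,
        mul_div_cancel₀ _ hCa.ne', mul_comm]
    rw [hℓΓ, _root_.smul_apply, smul_smul, e, quarterTurn_apply]
    ext i
    fin_cases i <;> simp [hTdef]
  have hcd : ContDiff ℝ (n + 2) Γ := contDiff_of_deriv_deriv_eq (contDiff_signPow n 1 hn) hΓ hT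
  have hcdT : ContDiff ℝ (n + 1) T := by
    rw [show T = deriv Γ from funext fun s => (hΓ s).deriv.symm]
    exact (contDiff_succ_iff_deriv.1
      (by rwa [add_assoc, one_add_one_eq_two] : ContDiff ℝ ((n : ℕ∞ω) + 1 + 1) Γ)).2.2
  obtain ⟨c, U, v, σ, t, hc, hσ, hγ⟩ := h.exists_affine hL harc hΓ hTn
  have haff : ∀ s, HasDerivAt (fun s => σ * s + t) σ s := fun s => by
    simpa using ((hasDerivAt_id s).const_mul σ).add_const t
  have haffc : ∀ {m : ℕ∞ω}, ContDiff ℝ m fun s => σ * s + t := by fun_prop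
  set Ul : Plane →L[ℝ] Plane := U.toContinuousLinearEquiv.toContinuousLinearMap with hUl
  set γ₁ : ℝ → Plane := fun s => c • Ul (Γ (σ * s + t)) + v with hγ₁
  set γ₂ : ℝ → Plane := fun s => (c * σ) • Ul (T (σ * s + t)) with hγ₂
  set W : ℝ → Plane := fun s => (c * σ ^ 2 * κ) • Ul (quarterTurn (T (σ * s + t))) with hW
  set w : ℝ → ℝ := fun s => ℓ (Γ (σ * s + t)) with hw
  have h₁ : ∀ s, HasDerivAt γ₁ (γ₂ s) s := fun s => by
    have e := (Ul.hasFDerivAt.comp_hasDerivAt s ((hΓ (σ * s + t)).scomp s (haff s))).const_smul c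
    refine (e.add_const v).congr_deriv ?_
    simp only [hγ₂, map_smul, smul_smul]
  have h₂ : ∀ s, HasDerivAt γ₂ (signPow 1 a (w s) • W s) s := fun s => by
    have e := (Ul.hasFDerivAt.comp_hasDerivAt s
      ((hT (σ * s + t)).scomp s (haff s))).const_smul (c * σ)
    refine e.congr_deriv ?_
    simp only [hW, hw, map_smul, _root_.smul_apply, smul_smul]
    ring_nf
  have hwd : ∀ s, HasDerivAt w (σ * wavelikeSin p q (σ * s + t)) s := fun s => by
    have e := ℓ.hasFDerivAt.comp_hasDerivAt s ((hΓ (σ * s + t)).scomp s (haff s))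
    refine e.congr_deriv ?_
    simp [hℓ, hTdef]
  have hw0 : ∀ s, w s = 0 → deriv w s ≠ 0 := fun s hs => by
    rw [(hwd s).deriv]
    rw [hw] at hs
    simp only [hℓΓ] at hs
    exact mul_ne_zero hσ (wavelikeSin_ne_zero_of_height_eq_zero hp1 hq0 hq1 hs)
  have hWn : ∀ s, W s ≠ 0 := fun s => by
    refine smul_ne_zero (mul_ne_zero (mul_ne_zero hc.ne' (pow_ne_zero 2 hσ)) hκ0) fun h => ?_
    have e : ‖Ul (quarterTurn (T (σ * s + t)))‖ = 1 := by
      rw [← hTn (σ * s + t), ← norm_quarterTurn (T (σ * s + t))]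
      exact U.norm_map _
    rw [h] at e
    simp at e
  have hwc : ContDiff ℝ (n + 2) w := ℓ.contDiff.comp (hcd.comp haffc)
  have hWc : ContDiff ℝ (n + 1) W :=
    contDiff_const.fun_smul (Ul.contDiff.comp (quarterTurn.contDiff.comp (hcdT.comp haffc)))
  obtain ⟨V, R, hV, hR, hV0, hVR⟩ := iteratedDeriv_eq_signPow_smul_add (γ := γ₁) hn
    (by rw [show deriv γ₁ = γ₂ from funext fun s => (h₁ s).deriv]
        exact funext fun s => (h₂ s).deriv)
    (hwc.of_le (by norm_cast; omega)) hWc (fun s _ => hWn s) hw0 (hwc.of_le (by norm_cast; omega))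
  refine ⟨γ₁, w, V, R, hγ, ?_, hwc.of_le (by norm_cast; omega), hV, hR, hV0, hw0, ?_, ?_, hVR⟩
  · exact ((Ul.contDiff.comp (hcd.comp haffc)).const_smul c).add contDiff_const
  · have hinj : Function.Injective fun s : ℝ => σ * s + t := fun x y hxy =>
      mul_left_cancel₀ hσ (add_right_cancel hxy)
    simp only [hw, hℓΓ]
    exact (countable_wavelikeHeight_eq_zero hp1 hp2 hq0 hq1).preimage hinj
  · rintro s ⟨hs, hks⟩
    -- Off the zeros of the height the acceleration is a non-zero multiple of the rotated tangent,
    -- so the curvature cannot vanish.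
    by_contra hws
    have hsp : signPow 1 a (w s) ≠ 0 := by
      rw [← abs_pos, abs_signPow _ _ hws]
      exact Real.rpow_pos_of_pos (abs_pos.2 hws) _
    refine signedCurvature_ne_zero hL hγ h₁ h₂ hs (hTn (σ * s + t))
      (k := signPow 1 a (w s) * (c * σ ^ 2 * κ)) (U := U)
      (mul_ne_zero hsp (mul_ne_zero (mul_ne_zero hc.ne' (pow_ne_zero 2 hσ)) hκ0))
      (mul_ne_zero hc.ne' hσ) rfl ?_ hks
    simp only [hW, smul_smul]
    rfl

lemma ae_eq_restrict_Ioo_of_eqOn_Icc {E : Type*} {L : ℝ} {f g : ℝ → E}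
    (h : ∀ s ∈ Icc 0 L, f s = g s) : f =ᵐ[volume.restrict (Ioo 0 L)] g :=
  (ae_restrict_iff' measurableSet_Ioo).2
    (Eventually.of_forall fun s hs => h s (Ioo_subset_Icc_self hs))

lemma IsWavelike.analyticOn {p L : ℝ} (hp1 : 1 < p) (hp2 : p ≤ 2) (hL : 0 < L)
    {γ : ℝ → Plane} (harc : IsArclength L γ) (h : IsWavelike p L γ) {N : ℕ} (hN : Odd N)
    (hpN : 1 / (p - 1) = N) : AnalyticOn ℝ γ (Icc 0 L) := by
  obtain ⟨q, ⟨hq0, hq1⟩, h⟩ := h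
  exact analyticOn_of_isRepresentedBy hL harc h (hasDerivAt_wavelikeAbscissa hp1 hp2 hq0 hq1)
    (hasDerivAt_wavelikeHeight hp1 hp2 hq0 hq1) (wavelikeCos_sq_add_wavelikeSin_sq hq0 hq1)
    (fun s => (analyticAt_wavelikeCos_wavelikeSin hp1 hp2 hq0 hq1 hN hpN s).1)
    (fun s => (analyticAt_wavelikeCos_wavelikeSin hp1 hp2 hq0 hq1 hN hpN s).2)

/-- The exponent `m_p` is `n + 1` with `n < 1 / (p - 1) ≤ n + 1`. -/
lemma exists_mExp_eq_add_one {p : ℝ} (hp1 : 1 < p) :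
    ∃ n : ℕ, mExp p = n + 1 ∧ (n : ℝ) < 1 / (p - 1) ∧ 1 / (p - 1) ≤ n + 1 := by
  have hpos : 0 < 1 / (p - 1) := one_div_pos.2 (by linarith)
  have h1 : 0 < mExp p := Nat.ceil_pos.2 hpos
  obtain ⟨n, hn⟩ := Nat.exists_eq_succ_of_ne_zero h1.ne'
  refine ⟨n, hn, Nat.lt_ceil.1 (show n < mExp p by omega), ?_⟩
  have := Nat.le_ceil (1 / (p - 1))
  rw [show ⌈1 / (p - 1)⌉₊ = n + 1 from hn] at this
  exact_mod_cast this

end PElastica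

end

/-! ### The regularity theorem -/

open PElastica in
theorem theorem1p4 (p L : ℝ) (hp1 : 1 < p) (hp2 : p ≤ 2) (hL : 0 < L)
    (γ : ℝ → Plane) (hγ : IsPElastica p L γ) (harc : IsArclength L γ) :
    ((IsLinear L γ ∨ IsBorderline p L γ ∨ IsOrbitlike p L γ ∨ IsCircular L γ) →
      AnalyticOn ℝ γ (Set.Icc 0 L)) ∧
    (IsWavelike p L γ → (curvatureZeroSet L γ).Nonempty →
      ((∃ n : ℤ, Odd n ∧ 1 / (p - 1) = (n : ℝ)) → AnalyticOn ℝ γ (Set.Icc 0 L)) ∧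
      ((∃ n : ℤ, Even n ∧ 1 / (p - 1) = (n : ℝ)) →
        MemSobolev 0 L (⊤ : ENNReal) (mExp p + 2) γ ∧
        ((curvatureZeroSet L γ ∩ Set.Ioo 0 L).Nonempty →
          ¬ MemSobolev 0 L 1 (mExp p + 3) γ)) ∧
      ((¬ ∃ n : ℤ, 1 / (p - 1) = (n : ℝ)) →
        (∀ r : ℝ, 1 ≤ r → r < rExp p →
          MemSobolev 0 L (ENNReal.ofReal r) (mExp p + 2) γ) ∧
        ¬ MemSobolev 0 L (ENNReal.ofReal (rExp p)) (mExp p + 2) γ)) := by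
  refine ⟨?_, fun hwave hZ => ?_⟩
  · rintro (h | h | ⟨q, ⟨hq0, hq1⟩, h⟩ | h)
    · exact analyticOn_of_isRepresentedBy hL harc h (fun s => hasDerivAt_id s)
        (fun s => hasDerivAt_const s 0) (fun s => by norm_num) (fun _ => analyticAt_const)
        fun _ => analyticAt_const
    · exact analyticOn_of_isBorderline hp1 hp2 hL harc h
    · exact analyticOn_of_isOrbitlike_profile hp1 hq0 hq1 hL harc h
    · exact analyticOn_of_isRepresentedBy hL harc h (fun s => Real.hasDerivAt_cos s)
        (fun s => Real.hasDerivAt_sin s) (fun s => by rw [neg_sq, Real.sin_sq_add_cos_sq])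
        (fun s => by fun_prop) fun s => by fun_prop
  · have hpos : 0 < 1 / (p - 1) := one_div_pos.2 (by linarith)
    refine ⟨?_, ?_⟩
    · rintro ⟨N, hN, hpN⟩
      have hN0 : 0 ≤ N := by
        have : (0 : ℝ) < N := hpN ▸ hpos
        exact_mod_cast this.le
      obtain ⟨N, rfl⟩ := Int.eq_ofNat_of_zero_le hN0
      exact hwave.analyticOn hp1 hp2 hL harc (by exact_mod_cast hN) (by exact_mod_cast hpN)
    obtain ⟨n, hmn, hn, hn'⟩ := exists_mExp_eq_add_one hp1
    obtain ⟨γ₁, w, V, R, hγ₁, hcd, hw, hV, hR, hV0, hw0, hc, hZw, hF⟩ :=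
      hwave.exists_iteratedDeriv_eq hp1 hp2 hL harc hn
    have hae := ae_eq_restrict_Ioo_of_eqOn_Icc hγ₁
    -- With `m_p = n + 1`, the order `m_p + 2` is just one beyond the continuous derivative of order
    -- `n + 2`, so membership is a condition on the single function `powDeriv`.
    set b : ℝ := 1 / (p - 1) - n with hb
    have hb0 : 0 < b := by linarith
    have hb1 : b ≤ 1 := by linarith
    have hiff : ∀ (r : ENNReal) (k : ℕ), MemSobolev 0 L r (k + (n + 2)) γ ↔
        MemSobolev 0 L r k fun s => signPow (1 + n) b (w s) • V s + R s := fun r k => by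
      rw [← hF, ← memSobolev_add_iff k (by exact_mod_cast hcd)]
      exact ⟨fun h => h.congr hae, fun h => h.congr hae.symm⟩
    have hweak := hasWeakDeriv_powDeriv (A := 0) (B := L) (k := 1 + n) hb0 hb1 hw hV hR hw0 hc
    have hFcont : Continuous fun s => signPow (1 + n) b (w s) • V s + R s :=
      (((continuous_signPow _ hb0).comp hw.continuous).smul hV.continuous).add hR.continuous
    have hiff1 : ∀ r : ENNReal, MemSobolev 0 L r (mExp p + 2) γ ↔
        MeasureTheory.MemLp (powDeriv (1 + n) b w V R) r
          (MeasureTheory.volume.restrict (Set.Ioo 0 L)) := fun r => by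
      rw [hmn, show n + 1 + 2 = 1 + (n + 2) by ring, hiff]
      constructor
      · rintro ⟨-, g, hg, h⟩
        exact h.ae_eq (hg.unique hweak)
      · exact fun h => ⟨memLp_Ioo_of_continuous hFcont, _, hweak, h⟩
    refine ⟨?_, ?_⟩
    · rintro ⟨N, hN, hpN⟩
      have hNn : N = n + 1 := by
        have h1 : (n : ℝ) < N := hpN ▸ hn
        have h2 : (N : ℝ) ≤ n + 1 := hpN ▸ hn'
        have h3 : (n : ℤ) < N := by exact_mod_cast h1
        have h4 : N ≤ n + 1 := by exact_mod_cast h2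
        omega
      have hb1' : b = 1 := by rw [hb, hpN, hNn]; push_cast; ring
      have hk : Even (1 + n) := by
        rw [hNn] at hN
        have : Even (n + 1) := by exact_mod_cast hN
        rwa [add_comm]
      rw [hiff1]
      refine ⟨memLp_powDeriv_of_memLp hb0 hw hV hR ?_, ?_⟩
      · simp only [hb1', sub_self, Real.rpow_zero]
        exact MeasureTheory.memLp_top_const 1
      · rintro ⟨s, hs, hsL⟩ hmem
        -- Two weak derivatives beyond order `n + 2`: by uniqueness the first is `powDeriv`, which
        -- would then be weakly differentiable despite its jump.
        rw [hmn, show n + 1 + 3 = 2 + (n + 2) by ring, hiff] at hmem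
        obtain ⟨-, g, hg, -, g₁, hg₁, -⟩ := hmem
        have hws := hZw s hs
        rw [hb1'] at hweak hg
        exact not_hasWeakDeriv_powDeriv_one hk hw hV hR hsL hws (hw0 s hws) (hV0 s hws) g₁
          (hg₁.congr (hg.unique hweak) (Filter.EventuallyEq.refl _ _))
    · intro hnint
      have hb1' : b < 1 := lt_of_le_of_ne hb1 fun h => hnint ⟨n + 1, by push_cast; linarith⟩
      -- `m_p - 1/(p-1) = (n + 1) - (n + b) = 1 - b`.
      have hr : rExp p = (1 - b)⁻¹ := by
        rw [rExp, hmn, hb]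
        push_cast
        ring_nf
      refine ⟨fun r hr1 hr2 => ?_, ?_⟩
      · rw [hiff1]
        refine memLp_powDeriv_of_memLp hb0 hw hV hR (memLp_abs_rpow (by linarith) ?_ hb1 hw hw0)
        rw [hr] at hr2
        rwa [lt_inv_comm₀ (by linarith) (by linarith), ← one_div, lt_div_iff₀' (by linarith)] at hr2
      · rw [hiff1, hr]
        obtain ⟨s, hs⟩ := hZ
        have hws := hZw s hs
        exact not_memLp_powDeriv hb0 hb1' hL hw hV hR hs.1 hws (hw0 s hws) (hV0 s hws)
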